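/- Consider a network with layers $\mathcal K=\{0,\dots,K\}$; layer $k$ has altitude $h_k$, association bias $B_k>0$, receiver density $\lambda_{k,\mathrm{Rx}}\ge 0$ and transmitter density $\lambda_{k,\mathrm{Tx}}\ge 0$. Put $h_{ik}=|h_i-h_k|$. A link of length $x\ge h_{ik}$ between a receiver of layer $i$ and a transmitter of layer $k$ is line-of-sight (L) with probability $\rho_{ik}^{(\mathrm L)}(x)\in[0,1]$ (a measurable function of $x$) and non-line-of-sight (N) with probability $\rho_{ik}^{(\mathrm N)}(x)=1-\rho_{ik}^{(\mathrm L)}(x)$; the pathloss exponents are $\alpha^{(\mathrm L)},\alpha^{(\mathrm N)}>0$. Let $o\in\{\mathrm r,\mathrm t\}$ be the association subject (receiver- or transmitter-oriented) and $a\in\{\mathrm n,\mathrm s\}$ the association criterion (nearest or strongest), and let $\tau=oa$. Fix a selecting node $\hat{\mathbf x}$ (a receiver if $o=\mathrm r$, a transmitter if $o=\mathrm t$). The candidate nodes of layer $k$ are the transmitters of layer $k$ if $o=\mathrm r$ and the receivers of layer $k$ if $o=\mathrm t$; they form a homogeneous Poisson point process on the plane at altitude $h_k$, of density $\lambda_{k,o}$,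 where $\lambda_{k,\mathrm r}=\lambda_{k,\mathrm{Tx}}$ and $\lambda_{k,\mathrm t}=\lambda_{k,\mathrm{Rx}}$, and the processes of different layers are independent. Given the locations, the L/N states of the links from $\hat{\mathbf x}$ are independent, with the above probabilities at the three-dimensional link lengths. The associated node $\mathbf x_\tau$ is a candidate $\mathbf x$, over all layers, that maximizes $B_k|\mathbf x-\hat{\mathbf x}|^{-1}$ if $a=\mathrm n$, and $B_k|\mathbf x-\hat{\mathbf x}|^{-\alpha^{(c_{\mathrm o})}}$ if $a=\mathrm s$, where $k$ is the layer of $\mathbf x$ and $c_{\mathrm o}$ is the state of its link (ties are broken arbitrarily). Consider main links between a receiver of layer $i$ and a transmitter of layer $j$ in state $c\in\{\mathrm L,\mathrm N\}$. Let $(p,q)$ be the layers of the selecting and of the selected node: $(p,q)=(i,j)$ if $o=\mathrm r$, and $(p,q)=(j,i)$ if $o=\mathrm t$; so $\hat{\mathbf x}$ is in layer $p$. Write $\varrho_{pk}^{(c_{\mathrm o})}=\rho_{pk}^{(c_{\mathrm o})}$ if $o=\mathrm r$ and $\varrho_{pk}^{(c_{\mathrm o})}=\rho_{kp}^{(c_{\mathrm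 o})}$ if $o=\mathrm t$. (1) For all $k\in\mathcal K$ and $c_{\mathrm o}\in\{\mathrm L,\mathrm N\}$, let $V_{pk,o}^{(c_{\mathrm o})}\in[0,\infty]$ be the distance from $\hat{\mathbf x}$ to the nearest candidate of layer $k$ whose link is in state $c_{\mathrm o}$ ($\infty$ if there is none). For all real $v$, $$\bar F_{V_{pk,o}^{(c_{\mathrm o})}}(v)=\mathbb P\big(V_{pk,o}^{(c_{\mathrm o})}>v\big)=\exp\Big[-\int_{h_{pk}}^{\max(v,h_{pk})}2\pi\lambda_{k,o}\,x\,\varrho_{pk}^{(c_{\mathrm o})}(x)\,dx\Big],$$ and on $\{V_{pk,o}^{(c_{\mathrm o})}<\infty\}$ the law of $V_{pk,o}^{(c_{\mathrm o})}$ has the (possibly defective) density $$f_{V_{pk,o}^{(c_{\mathrm o})}}(v)=2\pi\lambda_{k,o}\,v\,\varrho_{pk}^{(c_{\mathrm o})}(v)\exp\Big\{-\int_{h_{pk}}^{v}2\pi\lambda_{k,o}\,x\,\varrho_{pk}^{(c_{\mathrm o})}(x)\,dx\Big\}\ \text{ for } v\ge h_{pk},\qquad f_{V_{pk,o}^{(c_{\mathrm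 o})}}(v)=0\ \text{ for } v<h_{pk}.$$ (2) For $y>0$ let $$R_{k,c_{\mathrm o}}(y)=\begin{cases}y\,B_k/B_q & a=\mathrm n,\\ \big(y^{\alpha^{(c)}}B_k/B_q\big)^{1/\alpha^{(c_{\mathrm o})}} & a=\mathrm s.\end{cases}$$ The probability that the associated node lies in layer $q$ and its link is in state $c$ is $$\mathcal A_{ij,\tau}^{(c)}=\int_{x>0}f_{V_{pq,o}^{(c)}}(x)\prod_{(k,c_{\mathrm o})\ne(q,c)}\bar F_{V_{pk,o}^{(c_{\mathrm o})}}\big(R_{k,c_{\mathrm o}}(x)\big)\,dx,$$ where the product is over $k\in\mathcal K$ and $c_{\mathrm o}\in\{\mathrm L,\mathrm N\}$, and the integral converges. (3) If $\mathcal A_{ij,\tau}^{(c)}>0$, then, conditionally on the event in (2), the main link distance $Y_{ij,\tau}^{(c)}=|\mathbf x_\tau-\hat{\mathbf x}|$ has the probability density $$f_{Y_{ij,\tau}^{(c)}}(y)=\frac{f_{V_{pq,o}^{(c)}}(y)}{\mathcal A_{ij,\tau}^{(c)}}\prod_{(k,c_{\mathrm o})\ne(q,c)}\bar F_{V_{pk,o}^{(c_{\mathrm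 o})}}\big(R_{k,c_{\mathrm o}}(y)\big).$$ -/

import Mathlib

open MeasureTheory ProbabilityTheory
open scoped NNReal ENNReal

noncomputable section

namespace AerialNet

/-- State of a link: line of sight, or non line of sight. -/
inductive Channel
  | los
  | nlos
  deriving DecidableEq

instance : Fintype Channel where
  elems := {.los, .nlos}
  complete := by intro c; cases c <;> simp

/-- Role of a node. -/
inductive Role
  | rx
  | tx

/-- Association subject `o`: the end of the link that selects the other end. -/
inductive Subject
  | receiver
  | transmitter

/-- Association criterion `a`. -/
inductive Criterion
  | nearest
  | strongest

/-- Role of the nodes among which the association subject selects. -/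
def Subject.candidates : Subject → Role
  | .receiver => .tx
  | .transmitter => .rx

/-- Layer of the selecting end of a link from a `j`-layer transmitter to an `i`-layer receiver. -/
def Subject.selecting {ι : Type*} (o : Subject) (i j : ι) : ι :=
  match o with
  | .receiver => i
  | .transmitter => j

/-- Layer of the selected end of a link from a `j`-layer transmitter to an `i`-layer receiver. -/
def Subject.selected {ι : Type*} (o : Subject) (i j : ι) : ι :=
  match o with
  | .receiver => j
  | .transmitter => i

/-- The horizontal plane. -/
abbrev Plane : Type := EuclideanSpace ℝ (Fin 2)

/-- The point of three-dimensional space above `x` at altitude `h`. -/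
def atAltitude (x : Plane) (h : ℝ) : EuclideanSpace ℝ (Fin 3) := !₂[x 0, x 1, h]

/-- Parameters of a multi-layer aerial network with layers `0, …, K`. -/
structure Network (K : ℕ) where
  /-- altitude `h_k` -/
  altitude : Fin (K + 1) → ℝ
  /-- densities of the receivers and of the transmitters of a layer -/
  density : Role → Fin (K + 1) → ℝ≥0
  /-- association bias `B_k` -/
  bias : Fin (K + 1) → ℝ
  bias_pos : ∀ k, 0 < bias k
  /-- pathloss exponent `α^(c)` -/
  pathloss : Channel → ℝ
  pathloss_pos : ∀ c, 0 < pathloss c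
  /-- `losProb i j x` is the probability that a link of length `x` between an `i`-layer receiver
  and a `j`-layer transmitter is line of sight. -/
  losProb : Fin (K + 1) → Fin (K + 1) → ℝ → ℝ
  losProb_measurable : ∀ i j, Measurable (losProb i j)
  losProb_mem : ∀ i j x, |altitude i - altitude j| ≤ x → losProb i j x ∈ Set.Icc (0 : ℝ) 1

namespace Network

variable {K : ℕ}

/-- Altitude difference `h_{ij}`. -/
def gap (M : Network K) (i j : Fin (K + 1)) : ℝ := |M.altitude i - M.altitude j|

/-- `ρ_{ij}^(c) (x)` for an `i`-layer receiver and a `j`-layer transmitter. -/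
def channelProb (M : Network K) (i j : Fin (K + 1)) (c : Channel) (x : ℝ) : ℝ :=
  match c with
  | .los => M.losProb i j x
  | .nlos => 1 - M.losProb i j x

/-- Probability of channel `c` on a link of length `x` between a selecting node of layer `s` and a
candidate node of layer `k`. -/
def linkProb (M : Network K) (o : Subject) (s k : Fin (K + 1)) (c : Channel) (x : ℝ) : ℝ :=
  match o with
  | .receiver => M.channelProb s k c x
  | .transmitter => M.channelProb k s c x

/-- Length of the link between the selecting node, located in layer `s` above `u`, and a node
located in layer `k` above `x`. -/
def linkDist (M : Network K) (s : Fin (K + 1)) (u : Plane) (k : Fin (K + 1)) (x : Plane) : ℝ :=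
  dist (atAltitude x (M.altitude k)) (atAltitude u (M.altitude s))

/-- Association metric of a `k`-layer node at distance `d` whose link is in state `c`. It is
`ℝ≥0∞`-valued, so that it is infinite at distance zero. -/
def metric (M : Network K) (a : Criterion) (k : Fin (K + 1)) (c : Channel) (d : ℝ) : ℝ≥0∞ :=
  match a with
  | .nearest => ENNReal.ofReal (M.bias k) * (ENNReal.ofReal d)⁻¹
  | .strongest => ENNReal.ofReal (M.bias k) * ENNReal.ofReal d ^ (-M.pathloss c)

/-- The CCDF formula for the distance from a selecting node of layer `s` to the nearest candidate
of layer `k` in channel `c`. -/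
def nearestCCDF (M : Network K) (o : Subject) (s k : Fin (K + 1)) (c : Channel) (v : ℝ) : ℝ :=
  Real.exp (-∫ x in (M.gap s k)..(max v (M.gap s k)),
    2 * Real.pi * (M.density o.candidates k : ℝ) * x * M.linkProb o s k c x)

/-- The PDF formula for the distance from a selecting node of layer `s` to the nearest candidate
of layer `k` in channel `c`. -/
def nearestPDF (M : Network K) (o : Subject) (s k : Fin (K + 1)) (c : Channel) (v : ℝ) : ℝ :=
  if v < M.gap s k then 0 else
    2 * Real.pi * (M.density o.candidates k : ℝ) * v * M.linkProb o s k c v *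
      Real.exp (-∫ x in (M.gap s k)..v,
        2 * Real.pi * (M.density o.candidates k : ℝ) * x * M.linkProb o s k c x)

/-- `R(y)`: the exclusion distance for `k`-layer nodes in channel `c'` when the main link has
length `y`, goes to a node of layer `t` and is in channel `c`. -/
def exclusion (M : Network K) (a : Criterion) (t : Fin (K + 1)) (c : Channel)
    (k : Fin (K + 1)) (c' : Channel) (y : ℝ) : ℝ :=
  match a with
  | .nearest => y * M.bias k / M.bias t
  | .strongest => (y ^ M.pathloss c * M.bias k / M.bias t) ^ (1 / M.pathloss c')

/-- The nearest-node density of type `(t, c)` times the product of the CCDFs of all other types at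
their exclusion distances. -/
def mainLinkWeight (M : Network K) (o : Subject) (a : Criterion) (s t : Fin (K + 1)) (c : Channel)
    (y : ℝ) : ℝ :=
  M.nearestPDF o s t c y *
    ∏ p ∈ (Finset.univ : Finset (Fin (K + 1) × Channel)).erase (t, c),
      M.nearestCCDF o s p.1 p.2 (M.exclusion a t c p.1 p.2 y)

/-- The formula for the association probability. -/
def assocProb (M : Network K) (o : Subject) (a : Criterion) (s t : Fin (K + 1)) (c : Channel) :
    ℝ :=
  ∫ x in Set.Ioi (0 : ℝ), M.mainLinkWeight o a s t c x

/-- The formula for the PDF of the main link distance. -/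
def mainLinkPDF (M : Network K) (o : Subject) (a : Criterion) (s t : Fin (K + 1)) (c : Channel)
    (y : ℝ) : ℝ :=
  M.nearestPDF o s t c y / M.assocProb o a s t c *
    ∏ p ∈ (Finset.univ : Finset (Fin (K + 1) × Channel)).erase (t, c),
      M.nearestCCDF o s p.1 p.2 (M.exclusion a t c p.1 p.2 y)

end Network

/-- A random finite or infinite collection of points of the plane, with a measurable enumeration:
the points are `pt n` for `n < num`, and `pt n` is meaningless for the other `n`. -/
structure RandomPoints (Ω : Type*) [MeasurableSpace Ω] where
  num : Ω → ℕ∞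
  pt : ℕ → Ω → Plane
  measurable_num : Measurable num
  measurable_pt : ∀ n, Measurable (pt n)

namespace RandomPoints

variable {Ω : Type*} [MeasurableSpace Ω]

/-- Number of points in `A`. -/
def count (Φ : RandomPoints Ω) (A : Set Plane) (ω : Ω) : ℕ∞ :=
  Set.encard {n : ℕ | (n : ℕ∞) < Φ.num ω ∧ Φ.pt n ω ∈ A}

/-- The σ-algebra of the information on the locations of the points. -/
abbrev sigma (Φ : RandomPoints Ω) : MeasurableSpace Ω :=
  MeasurableSpace.comap Φ.num inferInstance ⊔
    ⨆ n, MeasurableSpace.comap (Φ.pt n) inferInstance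

/-- Homogeneous Poisson point process of density `lam`: the number of points in a Borel set of
finite area is Poisson with mean `lam` times the area, and the numbers of points in finitely many
disjoint such sets are independent. -/
structure IsPoisson (Φ : RandomPoints Ω) (P : Measure Ω) (lam : ℝ≥0) : Prop where
  law : ∀ A : Set Plane, MeasurableSet A → volume A ≠ ∞ → ∀ m : ℕ,
    P {ω | Φ.count A ω = m} = poissonMeasure (lam * (volume A).toNNReal) {m}
  indep : ∀ (r : ℕ) (A : Fin r → Set Plane), (∀ l, MeasurableSet (A l)) →
    (∀ l, volume (A l) ≠ ∞) → Pairwise (fun l l' => Disjoint (A l) (A l')) →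
    iIndepFun (fun l => Φ.count (A l)) P

end RandomPoints

section Links

variable {K : ℕ} {Ω : Type*} [MeasurableSpace Ω]

/-- `(k, n)` is one of the nodes. -/
def IsNode (Φ : Fin (K + 1) → RandomPoints Ω) (p : Fin (K + 1) × ℕ) (ω : Ω) : Prop :=
  (p.2 : ℕ∞) < (Φ p.1).num ω

/-- Distance of the node `(k, n)` to the selecting node, which is in layer `s` above `u`. -/
def nodeDist (M : Network K) (s : Fin (K + 1)) (u : Plane) (Φ : Fin (K + 1) → RandomPoints Ω)
    (p : Fin (K + 1) × ℕ) (ω : Ω) : ℝ :=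
  M.linkDist s u p.1 ((Φ p.1).pt p.2 ω)

/-- `state p` is the state of the link between the selecting node and node `p`. Given the
locations of all nodes, the states are independent, and a link of length `x` is in state `c` with
the probability that the network attributes to `c` at that length. -/
structure IsLinkState (M : Network K) (o : Subject) (s : Fin (K + 1)) (u : Plane)
    (Φ : Fin (K + 1) → RandomPoints Ω) (state : Fin (K + 1) × ℕ → Ω → Channel)
    (P : Measure Ω) : Prop where
  measurable : ∀ p c, MeasurableSet {ω | state p ω = c}
  cond : ∀ (S : Finset (Fin (K + 1) × ℕ)) (γ : Fin (K + 1) × ℕ → Channel),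
    ∀ᵐ ω ∂P, (∀ p ∈ S, IsNode Φ p ω) →
      (P[Set.indicator {ω' | ∀ p ∈ S, state p ω' = γ p} (fun _ => (1 : ℝ)) |
          ⨆ k, (Φ k).sigma]) ω =
        ∏ p ∈ S, M.linkProb o s p.1 (γ p) (nodeDist M s u Φ p ω)

/-- Distance from the selecting node to the nearest `k`-layer node whose link is in state `c`;
infinite if there is no such node. -/
def nearestDist (M : Network K) (s : Fin (K + 1)) (u : Plane) (Φ : Fin (K + 1) → RandomPoints Ω)
    (state : Fin (K + 1) × ℕ → Ω → Channel) (k : Fin (K + 1)) (c : Channel) (ω : Ω) : ℝ≥0∞ :=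
  ⨅ (n : ℕ) (_ : IsNode Φ (k, n) ω ∧ state (k, n) ω = c),
    ENNReal.ofReal (nodeDist M s u Φ (k, n) ω)

/-- `p` maximizes the association metric among all the nodes of all layers. -/
def IsBest (M : Network K) (a : Criterion) (s : Fin (K + 1)) (u : Plane)
    (Φ : Fin (K + 1) → RandomPoints Ω) (state : Fin (K + 1) × ℕ → Ω → Channel)
    (p : Fin (K + 1) × ℕ) (ω : Ω) : Prop :=
  IsNode Φ p ω ∧ ∀ q, IsNode Φ q ω →
    M.metric a q.1 (state q ω) (nodeDist M s u Φ q ω) ≤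
      M.metric a p.1 (state p ω) (nodeDist M s u Φ p ω)

/-- `sel` is almost surely a maximizer of the association metric, ties being broken arbitrarily,
and `none` if there is no maximizer. -/
def IsAssociation (M : Network K) (a : Criterion) (s : Fin (K + 1)) (u : Plane)
    (Φ : Fin (K + 1) → RandomPoints Ω) (state : Fin (K + 1) × ℕ → Ω → Channel)
    (sel : Ω → Option (Fin (K + 1) × ℕ)) (P : Measure Ω) : Prop :=
  ∀ᵐ ω ∂P, (∀ p, sel ω = some p → IsBest M a s u Φ state p ω) ∧
    (sel ω = none → ∀ p, ¬ IsBest M a s u Φ state p ω)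

/-- The event that the selected node is in layer `t` and its link is in state `c`. -/
def assocEvent (state : Fin (K + 1) × ℕ → Ω → Channel) (sel : Ω → Option (Fin (K + 1) × ℕ))
    (t : Fin (K + 1)) (c : Channel) : Set Ω :=
  {ω | ∃ n : ℕ, sel ω = some (t, n) ∧ state (t, n) ω = c}

/-- Distance to the selected node (zero if no node is selected). -/
def mainLinkDist (M : Network K) (s : Fin (K + 1)) (u : Plane)
    (Φ : Fin (K + 1) → RandomPoints Ω) (sel : Ω → Option (Fin (K + 1) × ℕ)) (ω : Ω) : ℝ :=
  match sel ω with
  | some p => nodeDist M s u Φ p ω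
  | none => 0

end Links

end AerialNet

end

noncomputable section

namespace AerialNet

open Filter Topology

/-! ### Counts and the probability generating functional of a Poisson process -/

namespace RandomPoints

variable {Ω : Type*} [MeasurableSpace Ω]

/-! Everything follows from one fact: the distances to the nearest candidates of the various types
(layer, link state) are independent, and each has the stated CCDF.

To obtain it, fix a threshold for every type. Given the locations, the states are independent, so
the probability that every candidate lies beyond the threshold of its type is a product over the
candidates of `beyondProb`, a function of the location. The expectation of such a product over a
Poisson process is the generating functional `exp (-λ ∫ (1 - g))`
(`IsPoisson.tendsto_integral_prod_mark`), and independence of the layers multiplies these values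
(`IsLinkState.measureReal_forall_beyond`). Since `1 - beyondProb` is a sum over the two states, the
exponent splits, and polar coordinates turn each piece into the exponent of a CCDF
(`exp_neg_integral_one_sub_beyondProb`). The joint survival function is thus a product over types,
which gives the marginals and the independence simultaneously. Differentiating the CCDF yields the
density.

For the association, a metric comparison between two types is a comparison of one distance with the
exclusion distance of the other (`metric_le_metric_iff`). Ties between different types are null,
because the distances are independent and have no finite atoms. Hence, up to a null set, type `(t,
c)` is selected exactly when its nearest node exists and all other nearest distances exceed their
exclusion distances (`mem_assocEvent_iff`). By independence, integrating over the value `y` of the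
nearest distance of type `(t, c)` gives its density times the product of the other CCDFs
(`measure_nearestWins_inter`). Total mass is the association probability; normalization gives the
conditional density. -/

theorem sigma_le (Φ : RandomPoints Ω) : Φ.sigma ≤ ‹MeasurableSpace Ω› :=
  sup_le Φ.measurable_num.comap_le (iSup_le fun n => (Φ.measurable_pt n).comap_le)

theorem measurable_num_sigma (Φ : RandomPoints Ω) : Measurable[Φ.sigma] Φ.num :=
  (comap_measurable Φ.num).mono le_sup_left le_rfl

theorem measurable_pt_sigma (Φ : RandomPoints Ω) (n : ℕ) : Measurable[Φ.sigma] (Φ.pt n) :=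
  (comap_measurable (Φ.pt n)).mono
    ((le_iSup (fun n => MeasurableSpace.comap (Φ.pt n) inferInstance) n).trans le_sup_right) le_rfl

theorem measurableSet_lt_num_sigma (Φ : RandomPoints Ω) (n : ℕ) :
    MeasurableSet[Φ.sigma] {ω | (n : ℕ∞) < Φ.num ω} :=
  Φ.measurable_num_sigma (MeasurableSet.of_discrete (s := Set.Ioi (n : ℕ∞)))

/-- A count is at least `m` exactly when some `m` indices all give points of `A`, and there are only
countably many finite sets of indices. -/
theorem measurable_count (Φ : RandomPoints Ω) {A : Set Plane} (hA : MeasurableSet A) :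
    Measurable (Φ.count A) := by
  have hS : ∀ n : ℕ, MeasurableSet {ω | (n : ℕ∞) < Φ.num ω ∧ Φ.pt n ω ∈ A} := fun n =>
    (Φ.sigma_le _ (Φ.measurableSet_lt_num_sigma n)).inter (Φ.measurable_pt n hA)
  have hge : ∀ m : ℕ, MeasurableSet {ω | (m : ℕ∞) ≤ Φ.count A ω} := by
    intro m
    have : {ω | (m : ℕ∞) ≤ Φ.count A ω} =
        ⋃ S : Finset ℕ, ⋃ (_ : S.card = m), ⋂ n ∈ S,
          {ω | (n : ℕ∞) < Φ.num ω ∧ Φ.pt n ω ∈ A} := by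
      ext ω
      simp only [Set.mem_ofPred_eq, Set.mem_iUnion, Set.mem_iInter, exists_prop]
      constructor
      · intro h
        obtain ⟨t, hts, htc⟩ := Set.exists_subset_encard_eq h
        have hfin : t.Finite := Set.finite_of_encard_eq_coe htc
        refine ⟨hfin.toFinset, ?_, fun n hn => hts (by simpa using hn)⟩
        rw [hfin.encard_eq_coe_toFinset_card] at htc
        exact_mod_cast htc
      · rintro ⟨S, hS, h⟩
        rw [← hS, ← Set.encard_coe_eq_coe_finsetCard]
        exact Set.encard_le_encard fun n hn => h n (by simpa using hn)
    rw [this]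
    exact MeasurableSet.iUnion fun S => MeasurableSet.iUnion fun _ =>
      Finset.measurableSet_biInter _ fun n _ => hS n
  refine measurable_to_countable' fun x => ?_
  induction x with
  | top =>
    have : Φ.count A ⁻¹' {⊤} = ⋂ m : ℕ, {ω | (m : ℕ∞) ≤ Φ.count A ω} := by
      ext ω
      simp only [Set.mem_preimage, Set.mem_singleton_iff, Set.mem_iInter, Set.mem_ofPred_eq]
      exact ⟨fun h m => by simp [h], fun h => ENat.eq_top_iff_forall_ge.2 h⟩
    rw [this]
    exact MeasurableSet.iInter hge
  | coe m =>
    have : Φ.count A ⁻¹' {(m : ℕ∞)} =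
        {ω | (m : ℕ∞) ≤ Φ.count A ω} \ {ω | ((m + 1 : ℕ) : ℕ∞) ≤ Φ.count A ω} := by
      ext ω
      simp only [Set.mem_preimage, Set.mem_singleton_iff, Set.mem_sdiff, Set.mem_ofPred_eq, not_le]
      push_cast
      rw [ENat.lt_add_one_iff (by simp)]
      exact ⟨fun h => by simp [h], fun h => le_antisymm h.2 h.1⟩
    rw [this]
    exact (hge m).diff (hge (m + 1))

variable {Φ : RandomPoints Ω} {P : Measure Ω} {lam : ℝ≥0}

/-- The Poisson masses of the finite values already sum to one. The image of the Poisson law is thus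
dominated by the law of the count and has the same total mass, so they coincide and no mass is left
for `⊤`. -/
theorem IsPoisson.map_count [IsProbabilityMeasure P] (h : Φ.IsPoisson P lam) {A : Set Plane}
    (hA : MeasurableSet A) (hA' : volume A ≠ ∞) :
    P.map (Φ.count A) =
      (poissonMeasure (lam * (volume A).toNNReal)).map (Nat.cast : ℕ → ℕ∞) := by
  have hc := Φ.measurable_count hA
  have := Measure.isProbabilityMeasure_map (μ := P) hc.aemeasurable
  have hle : (poissonMeasure (lam * (volume A).toNNReal)).map (Nat.cast : ℕ → ℕ∞) ≤
      P.map (Φ.count A) := by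
    refine Measure.le_iff.2 fun s hs => ?_
    rw [Measure.map_apply .of_discrete hs, ← Measure.tsum_indicator_apply_singleton _ _ .of_discrete]
    rw [← Measure.tsum_indicator_apply_singleton (P.map (Φ.count A)) _ hs]
    refine le_trans (ENNReal.tsum_le_tsum fun n => ?_)
      (ENNReal.tsum_comp_le_tsum_of_injective (Nat.cast_injective (R := ℕ∞)) _)
    by_cases hn : (n : ℕ∞) ∈ s
    · rw [Set.indicator_of_mem (by simpa using hn), Set.indicator_of_mem hn,
        Measure.map_apply hc .of_discrete, ← h.law A hA hA' n]
      rfl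
    · rw [Set.indicator_of_notMem (by simpa using hn)]
      exact zero_le
  exact (Measure.eq_of_le_of_measure_univ_eq hle (by simp)).symm

theorem IsPoisson.ae_count_ne_top [IsProbabilityMeasure P] (h : Φ.IsPoisson P lam) {A : Set Plane}
    (hA : MeasurableSet A) (hA' : volume A ≠ ∞) : ∀ᵐ ω ∂P, Φ.count A ω ≠ ⊤ := by
  have : P.map (Φ.count A) {⊤} = 0 := by
    rw [h.map_count hA hA', Measure.map_apply .of_discrete .of_discrete]
    convert measure_empty (μ := poissonMeasure (lam * (volume A).toNNReal))
    ext n; simp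
  rw [Measure.map_apply (Φ.measurable_count hA) .of_discrete] at this
  rw [ae_iff]
  simp only [ne_eq, not_not]
  exact this

theorem IsPoisson.integral_pow_count [IsProbabilityMeasure P] (h : Φ.IsPoisson P lam)
    {A : Set Plane} (hA : MeasurableSet A) (hA' : volume A ≠ ∞) (z : ℝ) :
    ∫ ω, z ^ (Φ.count A ω).toNat ∂P = Real.exp (-(lam * (volume.real A * (1 - z)))) := by
  have h1 : ∫ ω, z ^ (Φ.count A ω).toNat ∂P = ∫ m, z ^ (m : ℕ∞).toNat ∂(P.map (Φ.count A)) :=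
    (integral_map (f := fun m : ℕ∞ => z ^ m.toNat) (Φ.measurable_count hA).aemeasurable
      Measurable.of_discrete.aestronglyMeasurable).symm
  rw [h1, h.map_count hA hA', integral_map_cast_poissonMeasure]
  simp only [ENat.toNat_natCast, smul_eq_mul]
  set r : ℝ≥0 := lam * (volume A).toNNReal with hr
  have h2 : ∀ n : ℕ, Real.exp (-r) * r ^ n / (n.factorial) * z ^ n =
      Real.exp (-r) * ((r * z) ^ n / n.factorial) := fun n => by rw [mul_pow]; ring
  simp_rw [h2]
  rw [tsum_mul_left, (NormedSpace.expSeries_div_hasSum_exp (r * z : ℝ)).tsum_eq,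
    ← Real.exp_eq_exp_ℝ, ← Real.exp_add]
  congr 1
  simp only [hr, NNReal.coe_mul, ENNReal.coe_toNNReal_eq_toReal, measureReal_def]
  ring

/-- The value of `g` at the point number `n`, or one if there is no such point. -/
def mark (Φ : RandomPoints Ω) (g : Plane → ℝ) (n : ℕ) (ω : Ω) : ℝ :=
  open Classical in if (n : ℕ∞) < Φ.num ω then g (Φ.pt n ω) else 1

theorem measurable_mark_sigma (Φ : RandomPoints Ω) {g : Plane → ℝ} (hg : Measurable g) (n : ℕ) :
    Measurable[Φ.sigma] (Φ.mark g n) := by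
  unfold mark
  exact Measurable.ite (Φ.measurableSet_lt_num_sigma n) (hg.comp (Φ.measurable_pt_sigma n))
    measurable_const

theorem measurable_mark (Φ : RandomPoints Ω) {g : Plane → ℝ} (hg : Measurable g) (n : ℕ) :
    Measurable (Φ.mark g n) :=
  (Φ.measurable_mark_sigma hg n).mono Φ.sigma_le le_rfl

theorem mark_mem (Φ : RandomPoints Ω) {g : Plane → ℝ} (hg : ∀ x, g x ∈ Set.Icc (0 : ℝ) 1)
    (n : ℕ) (ω : Ω) : Φ.mark g n ω ∈ Set.Icc (0 : ℝ) 1 := by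
  unfold mark
  split_ifs
  · exact hg _
  · simp

theorem mark_mono (Φ : RandomPoints Ω) {f g : Plane → ℝ} (h : ∀ x, f x ≤ g x) (n : ℕ) (ω : Ω) :
    Φ.mark f n ω ≤ Φ.mark g n ω := by
  unfold mark
  split_ifs
  · exact h _
  · exact le_rfl

theorem prod_mark_mem (Φ : RandomPoints Ω) {g : Plane → ℝ} (hg : ∀ x, g x ∈ Set.Icc (0 : ℝ) 1)
    (s : Finset ℕ) (ω : Ω) : ∏ n ∈ s, Φ.mark g n ω ∈ Set.Icc (0 : ℝ) 1 :=
  ⟨Finset.prod_nonneg fun n _ => (Φ.mark_mem hg n ω).1,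
    Finset.prod_le_one (fun n _ => (Φ.mark_mem hg n ω).1) fun n _ => (Φ.mark_mem hg n ω).2⟩

theorem integrable_prod_mark [IsProbabilityMeasure P] (Φ : RandomPoints Ω) {g : Plane → ℝ}
    (hg : Measurable g) (hg' : ∀ x, g x ∈ Set.Icc (0 : ℝ) 1) (s : Finset ℕ) :
    Integrable (fun ω => ∏ n ∈ s, Φ.mark g n ω) P :=
  Integrable.of_mem_Icc 0 1
    (Finset.measurable_fun_prod _ fun n _ => Φ.measurable_mark hg n).aemeasurable
    (ae_of_all _ fun ω => Φ.prod_mark_mem hg' s ω)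

/-- The step function with the value `z l` on `A l`, and one off these sets. -/
def step {r : ℕ} (A : Fin r → Set Plane) (z : Fin r → ℝ) (x : Plane) : ℝ :=
  open Classical in ∏ l, if x ∈ A l then z l else 1

section Step

variable {r : ℕ} {A : Fin r → Set Plane} {z : Fin r → ℝ}

theorem step_of_mem (hd : Pairwise fun l l' => Disjoint (A l) (A l')) {l : Fin r} {x : Plane}
    (hx : x ∈ A l) : step A z x = z l := by
  unfold step
  rw [Finset.prod_eq_single l, if_pos hx]
  · intro l' _ hl
    rw [if_neg]
    exact fun hx' => Set.disjoint_left.1 (hd hl) hx' hx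
  · simp

theorem step_of_notMem {x : Plane} (hx : ∀ l, x ∉ A l) : step A z x = 1 :=
  Finset.prod_eq_one fun l _ => if_neg (hx l)

theorem measurable_step (hA : ∀ l, MeasurableSet (A l)) : Measurable (step A z) :=
  Finset.measurable_fun_prod _ fun l _ => Measurable.ite (hA l) measurable_const measurable_const

theorem step_mem (hz : ∀ l, z l ∈ Set.Icc (0 : ℝ) 1) (x : Plane) :
    step A z x ∈ Set.Icc (0 : ℝ) 1 := by
  have : ∀ l, (open Classical in if x ∈ A l then z l else 1) ∈ Set.Icc (0 : ℝ) 1 := by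
    intro l
    split_ifs
    · exact hz l
    · simp
  exact ⟨Finset.prod_nonneg fun l _ => (this l).1,
    Finset.prod_le_one (fun l _ => (this l).1) fun l _ => (this l).2⟩

theorem integral_one_sub_step (hA : ∀ l, MeasurableSet (A l)) (hA' : ∀ l, volume (A l) ≠ ∞)
    (hd : Pairwise fun l l' => Disjoint (A l) (A l')) :
    ∫ x, (1 - step A z x) = ∑ l, volume.real (A l) * (1 - z l) := by
  have : ∀ x, 1 - step A z x = ∑ l, (A l).indicator (fun _ => 1 - z l) x := by
    intro x
    by_cases hx : ∃ l, x ∈ A l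
    · obtain ⟨l, hl⟩ := hx
      rw [step_of_mem hd hl, Finset.sum_eq_single l, Set.indicator_of_mem hl]
      · intro l' _ hl'
        exact Set.indicator_of_notMem (fun hx' => Set.disjoint_left.1 (hd hl') hx' hl) _
      · simp
    · push Not at hx
      rw [step_of_notMem hx, Finset.sum_eq_zero, sub_self]
      exact fun l _ => Set.indicator_of_notMem (hx l) _
  simp_rw [this]
  rw [integral_finsetSum]
  · refine Finset.sum_congr rfl fun l _ => ?_
    rw [integral_indicator (hA l), setIntegral_const, smul_eq_mul]
  · intro l _
    exact (integrable_indicator_iff (hA l)).2 (integrableOn_const (hA' l))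

/-- Each `A l` contains finitely many points, so its factor is complete once `N` passes their
indices; points off all the sets contribute one. -/
theorem prod_mark_step (Φ : RandomPoints Ω) (ω : Ω) (hfin : ∀ l, Φ.count (A l) ω ≠ ⊤) :
    ∀ᶠ N in atTop, ∏ n ∈ Finset.range N, Φ.mark (step A z) n ω =
      ∏ l, z l ^ (Φ.count (A l) ω).toNat := by
  classical
  have hf : ∀ l, {n : ℕ | (n : ℕ∞) < Φ.num ω ∧ Φ.pt n ω ∈ A l}.Finite := fun l =>
    Set.encard_ne_top_iff.1 (hfin l)
  have hev : ∀ l, ∀ᶠ N in atTop, ∀ n ∈ (hf l).toFinset, n < N := fun l => by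
    filter_upwards [eventually_gt_atTop ((hf l).toFinset.sup id)] with N hN n hn
    exact lt_of_le_of_lt (Finset.le_sup (f := id) hn) hN
  filter_upwards [eventually_all.2 hev] with N hN
  have h1 : ∀ n, Φ.mark (step A z) n ω =
      ∏ l, if (n : ℕ∞) < Φ.num ω ∧ Φ.pt n ω ∈ A l then z l else 1 := by
    intro n
    unfold mark step
    by_cases hn : (n : ℕ∞) < Φ.num ω
    · simp [hn]
    · simp [hn]
  simp_rw [h1]
  rw [Finset.prod_comm]
  refine Finset.prod_congr rfl fun l _ => ?_
  rw [Finset.prod_ite, Finset.prod_const, Finset.prod_const_one, mul_one]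
  congr 1
  unfold count
  rw [(hf l).encard_eq_coe_toFinset_card, ENat.toNat_natCast]
  congr 1
  ext n
  simp only [Finset.mem_filter, Finset.mem_range, Set.Finite.mem_toFinset, Set.mem_ofPred_eq,
    and_iff_right_iff_imp]
  exact fun hn => hN l n (by simpa using hn)

/-- Independence of the counts factors the expectation of the limit into Poisson generating
functions. Dominated convergence with bound one then moves the limit inside. -/
theorem IsPoisson.tendsto_integral_prod_mark_step [IsProbabilityMeasure P] (h : Φ.IsPoisson P lam)
    (hA : ∀ l, MeasurableSet (A l)) (hA' : ∀ l, volume (A l) ≠ ∞)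
    (hd : Pairwise fun l l' => Disjoint (A l) (A l')) (hz : ∀ l, z l ∈ Set.Icc (0 : ℝ) 1) :
    Tendsto (fun N => ∫ ω, ∏ n ∈ Finset.range N, Φ.mark (step A z) n ω ∂P) atTop
      (𝓝 (Real.exp (-(lam * ∫ x, (1 - step A z x))))) := by
  have hlim : ∫ ω, ∏ l, z l ^ (Φ.count (A l) ω).toNat ∂P =
      Real.exp (-(lam * ∫ x, (1 - step A z x))) := by
    rw [(h.indep r A hA hA' hd).integral_fun_prod_comp
      (f := fun l (m : ℕ∞) => z l ^ m.toNat)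
      (fun l => (Φ.measurable_count (hA l)).aemeasurable)
      (fun l => Measurable.of_discrete.aestronglyMeasurable), integral_one_sub_step hA hA' hd]
    simp_rw [fun l => h.integral_pow_count (hA l) (hA' l) (z l)]
    rw [← Real.exp_sum, Finset.sum_neg_distrib, Finset.mul_sum]
  rw [← hlim]
  refine tendsto_integral_of_dominated_convergence (fun _ => 1) (fun N => ?_)
    (integrable_const _) (fun N => ae_of_all _ fun ω => ?_) ?_
  · exact (Finset.measurable_fun_prod _ fun n _ =>
      Φ.measurable_mark (measurable_step hA) n).aestronglyMeasurable
  · have := Φ.prod_mark_mem (step_mem (A := A) hz) (Finset.range N) ω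
    rw [Real.norm_eq_abs, abs_of_nonneg this.1]
    exact this.2
  · filter_upwards [ae_all_iff.2 fun l => h.ae_count_ne_top (hA l) (hA' l)] with ω hω
    exact tendsto_nhds_of_eventually_eq (Φ.prod_mark_step ω hω)

end Step

/-- A function which is approximated from below and from above by functions for which the formula
for the generating functional holds also satisfies it. -/
theorem tendsto_integral_prod_mark_of_approx [IsProbabilityMeasure P] {g : Plane → ℝ}
    {lo up : ℕ → Plane → ℝ} {L : ℝ} {Llo Lup : ℕ → ℝ}
    (hg : Measurable g) (hg' : ∀ x, g x ∈ Set.Icc (0 : ℝ) 1)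
    (hlo : ∀ m, Measurable (lo m)) (hlo' : ∀ m x, lo m x ∈ Set.Icc (0 : ℝ) 1)
    (hup : ∀ m, Measurable (up m)) (hup' : ∀ m x, up m x ∈ Set.Icc (0 : ℝ) 1)
    (hle : ∀ m x, lo m x ≤ g x) (hge : ∀ m x, g x ≤ up m x)
    (hL : ∀ m, Tendsto (fun N => ∫ ω, ∏ n ∈ Finset.range N, Φ.mark (lo m) n ω ∂P) atTop
      (𝓝 (Llo m)))
    (hU : ∀ m, Tendsto (fun N => ∫ ω, ∏ n ∈ Finset.range N, Φ.mark (up m) n ω ∂P) atTop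
      (𝓝 (Lup m)))
    (hLlim : Tendsto Llo atTop (𝓝 L)) (hUlim : Tendsto Lup atTop (𝓝 L)) :
    Tendsto (fun N => ∫ ω, ∏ n ∈ Finset.range N, Φ.mark g n ω ∂P) atTop (𝓝 L) := by
  -- For each fixed `N` the expected product is monotone in the function, so a single sufficiently
  -- large `m` serves for all large `N` and no limits are interchanged.
  refine tendsto_order.2 ⟨fun b hb => ?_, fun b hb => ?_⟩
  · obtain ⟨m, hm⟩ := (hLlim.eventually_const_lt hb).exists
    filter_upwards [(hL m).eventually_const_lt hm] with N hN
    refine hN.trans_le (integral_mono (Φ.integrable_prod_mark (hlo m) (hlo' m) _)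
      (Φ.integrable_prod_mark hg hg' _) fun ω => ?_)
    exact Finset.prod_le_prod (fun n _ => (Φ.mark_mem (hlo' m) n ω).1)
      fun n _ => Φ.mark_mono (hle m) n ω
  · obtain ⟨m, hm⟩ := (hUlim.eventually_lt_const hb).exists
    filter_upwards [(hU m).eventually_lt_const hm] with N hN
    refine lt_of_le_of_lt (integral_mono (Φ.integrable_prod_mark hg hg' _)
      (Φ.integrable_prod_mark (hup m) (hup' m) _) fun ω => ?_) hN
    exact Finset.prod_le_prod (fun n _ => (Φ.mark_mem hg' n ω).1)
      fun n _ => Φ.mark_mono (hge m) n ω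

/-- Probability generating functional of a Poisson process. -/
theorem IsPoisson.tendsto_integral_prod_mark [IsProbabilityMeasure P] (h : Φ.IsPoisson P lam)
    {g : Plane → ℝ} (hg : Measurable g) (hg' : ∀ x, g x ∈ Set.Icc (0 : ℝ) 1)
    {D : Set Plane} (hD : MeasurableSet D) (hD' : volume D ≠ ∞) (hgD : ∀ x ∉ D, g x = 1) :
    Tendsto (fun N => ∫ ω, ∏ n ∈ Finset.range N, Φ.mark g n ω ∂P) atTop
      (𝓝 (Real.exp (-(lam * ∫ x, (1 - g x))))) := by
  -- The cells are the level sets of `g` rounded down to a multiple of `1 / (m + 1)`; the value `g =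
  -- 1` accounts for the extra index `m + 1`. Cutting with `D` makes their areas finite, and off `D`
  -- both step functions equal `g = 1`. The upper value is capped at one.
  let A : (m : ℕ) → Fin (m + 2) → Set Plane := fun m l => D ∩ {x | ⌊(m + 1 : ℝ) * g x⌋₊ = l}
  let zlo : (m : ℕ) → Fin (m + 2) → ℝ := fun m l => (l : ℝ) / (m + 1)
  let zup : (m : ℕ) → Fin (m + 2) → ℝ := fun m l => min (((l : ℝ) + 1) / (m + 1)) 1
  have hA : ∀ m l, MeasurableSet (A m l) := fun m l =>
    hD.inter (measurableSet_eq_fun (Nat.measurable_floor.comp (hg.const_mul _)) measurable_const)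
  have hA' : ∀ m l, volume (A m l) ≠ ∞ := fun m l =>
    ne_top_of_le_ne_top hD' (measure_mono Set.inter_subset_left)
  have hd : ∀ m, Pairwise fun l l' => Disjoint (A m l) (A m l') := fun m l l' hl =>
    Set.disjoint_left.2 fun x hx hx' => hl (Fin.ext (hx.2.symm.trans hx'.2))
  have hzlo : ∀ m l, zlo m l ∈ Set.Icc (0 : ℝ) 1 := fun m l => by
    refine ⟨by positivity, ?_⟩
    rw [div_le_one (by positivity)]
    exact_mod_cast Nat.lt_succ_iff.1 l.2
  have hzup : ∀ m l, zup m l ∈ Set.Icc (0 : ℝ) 1 := fun m l =>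
    ⟨le_min (by positivity) zero_le_one, min_le_right _ _⟩
  have hcases : ∀ (m : ℕ) (x : Plane), (x ∉ D ∧ ∀ z, step (A m) z x = 1) ∨
      ∃ l : Fin (m + 2), (∀ z, step (A m) z x = z l) ∧ ⌊(m + 1 : ℝ) * g x⌋₊ = l := by
    intro m x
    by_cases hx : x ∈ D
    · have hl : ⌊(m + 1 : ℝ) * g x⌋₊ < m + 2 := by
        rw [Nat.floor_lt (mul_nonneg (by positivity) (hg' x).1)]
        push_cast
        nlinarith [(hg' x).2]
      exact Or.inr ⟨⟨_, hl⟩, fun z => step_of_mem (hd m) ⟨hx, rfl⟩, rfl⟩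
    · exact Or.inl ⟨hx, fun z => step_of_notMem fun l hl => hx hl.1⟩
  have hbounds : ∀ (m : ℕ) (x : Plane), step (A m) (zlo m) x ≤ g x ∧ g x ≤ step (A m) (zup m) x ∧
      g x - 1 / (m + 1) ≤ step (A m) (zlo m) x ∧ step (A m) (zup m) x ≤ g x + 1 / (m + 1) := by
    intro m x
    have hm : (0 : ℝ) < m + 1 := by positivity
    have hm' : 0 ≤ 1 / ((m : ℝ) + 1) := by positivity
    rcases hcases m x with ⟨hx, h1⟩ | ⟨l, hl, hfl⟩
    · rw [h1, h1, hgD x hx]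
      exact ⟨le_rfl, le_rfl, by linarith, by linarith⟩
    · rw [hl, hl]
      have hlow : (l : ℝ) ≤ (m + 1) * g x := by
        rw [← hfl]; exact Nat.floor_le (mul_nonneg hm.le (hg' x).1)
      have hupp : (m + 1) * g x < (l : ℝ) + 1 := by
        rw [← hfl]; exact Nat.lt_floor_add_one _
      have hlow' : (l : ℝ) / (m + 1) ≤ g x := by
        rw [div_le_iff₀ hm]; linarith
      have hupp' : g x ≤ ((l : ℝ) + 1) / (m + 1) := by
        rw [le_div_iff₀ hm]; linarith
      refine ⟨hlow', le_min hupp' (hg' x).2, ?_, (min_le_left _ _).trans ?_⟩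
      · simp only [zlo]
        rw [add_div] at hupp'
        linarith
      · rw [add_div]
        linarith
  have hlim : ∀ z : (m : ℕ) → Fin (m + 2) → ℝ, (∀ m l, z m l ∈ Set.Icc (0 : ℝ) 1) →
      (∀ (m : ℕ) x, |step (A m) (z m) x - g x| ≤ 1 / (m + 1)) →
      Tendsto (fun m => Real.exp (-(lam * ∫ x, (1 - step (A m) (z m) x)))) atTop
        (𝓝 (Real.exp (-(lam * ∫ x, (1 - g x))))) := by
    intro z hz hzg
    refine (Real.continuous_exp.tendsto _).comp (Tendsto.neg (Tendsto.const_mul _ ?_))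
    refine tendsto_integral_of_dominated_convergence (D.indicator fun _ => 1)
      (fun m => ((measurable_step (hA m)).const_sub 1).aestronglyMeasurable)
      ((integrable_indicator_iff hD).2 (integrableOn_const hD'))
      (fun m => ae_of_all _ fun x => ?_) (ae_of_all _ fun x => ?_)
    · have hs := step_mem (A := A m) (hz m) x
      rcases hcases m x with ⟨hx, h1⟩ | ⟨l, hl, hfl⟩
      · rw [h1, Set.indicator_of_notMem hx]; simp
      · by_cases hx : x ∈ D
        · rw [Set.indicator_of_mem hx, Real.norm_eq_abs, abs_of_nonneg (by linarith [hs.2])]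
          linarith [hs.1]
        · rw [Set.indicator_of_notMem hx, step_of_notMem fun l hl => hx hl.1]; simp
    · refine Tendsto.const_sub _ (tendsto_iff_dist_tendsto_zero.2 ?_)
      exact squeeze_zero (fun m => dist_nonneg) (fun m => hzg m x)
        tendsto_one_div_add_atTop_nhds_zero_nat
  exact tendsto_integral_prod_mark_of_approx (lo := fun m => step (A m) (zlo m))
    (up := fun m => step (A m) (zup m)) hg hg'
    (fun m => measurable_step (hA m)) (fun m => step_mem (hzlo m))
    (fun m => measurable_step (hA m)) (fun m => step_mem (hzup m))
    (fun m x => (hbounds m x).1) (fun m x => (hbounds m x).2.1)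
    (fun m => h.tendsto_integral_prod_mark_step (hA m) (hA' m) (hd m) (hzlo m))
    (fun m => h.tendsto_integral_prod_mark_step (hA m) (hA' m) (hd m) (hzup m))
    (hlim zlo hzlo fun m x => by
      obtain ⟨h1, h2, h3, h4⟩ := hbounds m x
      rw [abs_le]; constructor <;> linarith [show 0 ≤ 1 / ((m : ℝ) + 1) by positivity])
    (hlim zup hzup fun m x => by
      obtain ⟨h1, h2, h3, h4⟩ := hbounds m x
      rw [abs_le]; constructor <;> linarith [show 0 ≤ 1 / ((m : ℝ) + 1) by positivity])

end RandomPoints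

/-! ### Link lengths, state probabilities and the thinning function -/

theorem Channel.sum_univ {β : Type*} [AddCommMonoid β] (f : Channel → β) :
    ∑ c, f c = f .los + f .nlos := by
  rw [show (Finset.univ : Finset Channel) = {.los, .nlos} from rfl, Finset.sum_pair (by simp)]

namespace Network

variable {K : ℕ} (M : Network K) (o : Subject) (s k : Fin (K + 1)) (u : Plane)

theorem gap_nonneg : 0 ≤ M.gap s k := abs_nonneg _

theorem linkDist_eq_sqrt (x : Plane) :
    M.linkDist s u k x = √(‖x - u‖ ^ 2 + M.gap s k ^ 2) := by
  rw [linkDist, EuclideanSpace.dist_eq, Fin.sum_univ_three, ← dist_eq_norm,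
    EuclideanSpace.dist_eq, Fin.sum_univ_two, Real.sq_sqrt (by positivity)]
  simp [atAltitude, gap, Real.dist_eq, abs_sub_comm (M.altitude k)]

theorem continuous_linkDist : Continuous (M.linkDist s u k) := by
  simp_rw [funext (M.linkDist_eq_sqrt s k u)]
  fun_prop

theorem gap_le_linkDist (x : Plane) : M.gap s k ≤ M.linkDist s u k x := by
  rw [linkDist_eq_sqrt]
  exact Real.le_sqrt_of_sq_le (by nlinarith [sq_nonneg ‖x - u‖])

theorem linkDist_nonneg (x : Plane) : 0 ≤ M.linkDist s u k x := dist_nonneg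

theorem norm_sub_le_linkDist (x : Plane) : ‖x - u‖ ≤ M.linkDist s u k x := by
  rw [linkDist_eq_sqrt]
  exact Real.le_sqrt_of_sq_le (by nlinarith [sq_nonneg (M.gap s k)])

theorem measurable_linkProb (c : Channel) : Measurable (M.linkProb o s k c) := by
  cases o <;> cases c
  · exact M.losProb_measurable s k
  · exact (M.losProb_measurable s k).const_sub 1
  · exact M.losProb_measurable k s
  · exact (M.losProb_measurable k s).const_sub 1

theorem linkProb_mem (c : Channel) {x : ℝ} (hx : M.gap s k ≤ x) :
    M.linkProb o s k c x ∈ Set.Icc (0 : ℝ) 1 := by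
  have h1 := M.losProb_mem s k x hx
  have h2 := M.losProb_mem k s x (by rwa [abs_sub_comm])
  cases o <;> cases c <;> simp only [linkProb, channelProb, Set.mem_Icc] at * <;>
    constructor <;> linarith

theorem sum_linkProb (x : ℝ) : ∑ c, M.linkProb o s k c x = 1 := by
  rw [Channel.sum_univ]
  cases o <;> simp [linkProb, channelProb]

/-- Probability that a `k`-layer node above `x` is, in the channel `c` of its link, farther away
than `v (k, c)`. -/
def beyondProb (v : Fin (K + 1) × Channel → ℝ) (x : Plane) : ℝ :=
  ∑ c, if v (k, c) < M.linkDist s u k x then M.linkProb o s k c (M.linkDist s u k x) else 0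

variable (v : Fin (K + 1) × Channel → ℝ)

theorem measurable_beyondProb : Measurable (M.beyondProb o s k u v) := by
  have hd := (M.continuous_linkDist s k u).measurable
  exact Finset.measurable_fun_sum _ fun c _ => Measurable.ite
    (measurableSet_lt measurable_const hd) ((M.measurable_linkProb o s k c).comp hd)
    measurable_const

theorem beyondProb_mem (x : Plane) : M.beyondProb o s k u v x ∈ Set.Icc (0 : ℝ) 1 := by
  have h := fun c => M.linkProb_mem o s k c (M.gap_le_linkDist s k u x)
  constructor
  · refine Finset.sum_nonneg fun c _ => ?_
    split_ifs
    · exact (h c).1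
    · exact le_rfl
  · rw [← M.sum_linkProb o s k (M.linkDist s u k x)]
    refine Finset.sum_le_sum fun c _ => ?_
    split_ifs
    · exact le_rfl
    · exact (h c).1

theorem one_sub_beyondProb (x : Plane) : 1 - M.beyondProb o s k u v x =
    ∑ c, if M.linkDist s u k x ≤ v (k, c) then M.linkProb o s k c (M.linkDist s u k x) else 0 := by
  rw [← M.sum_linkProb o s k (M.linkDist s u k x), beyondProb, ← Finset.sum_sub_distrib]
  refine Finset.sum_congr rfl fun c _ => ?_
  by_cases h : v (k, c) < M.linkDist s u k x
  · simp [h]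
  · simp [h, not_lt.1 h]

/-- A link is at least as long as its horizontal projection. Outside a large disc both thresholds
are therefore exceeded, and the state probabilities sum to one. This supplies the set of finite area
that the generating functional requires. -/
theorem exists_beyondProb_eq_one :
    ∃ R : ℝ, ∀ x ∉ Metric.closedBall u R, M.beyondProb o s k u v x = 1 := by
  refine ⟨∑ c, |v (k, c)|, fun x hx => ?_⟩
  rw [← M.sum_linkProb o s k (M.linkDist s u k x), beyondProb]
  refine Finset.sum_congr rfl fun c _ => if_pos ?_
  rw [Metric.mem_closedBall, not_le, dist_eq_norm] at hx
  calc v (k, c) ≤ |v (k, c)| := le_abs_self _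
    _ ≤ ∑ c, |v (k, c)| :=
      Finset.single_le_sum (f := fun c => |v (k, c)|) (fun c _ => abs_nonneg _) (Finset.mem_univ c)
    _ < _ := hx.trans_le (M.norm_sub_le_linkDist s k u x)

end Network

/-! ### Integrating out the link states -/

section Thinning

variable {K : ℕ} {Ω : Type*} [MeasurableSpace Ω] {M : Network K} {o : Subject}
  {s : Fin (K + 1)} {u : Plane} {P : Measure Ω} {Φ : Fin (K + 1) → RandomPoints Ω}
  {state : Fin (K + 1) × ℕ → Ω → Channel}

theorem iSup_sigma_le (Φ : Fin (K + 1) → RandomPoints Ω) :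
    ⨆ k, (Φ k).sigma ≤ ‹MeasurableSpace Ω› :=
  iSup_le fun k => (Φ k).sigma_le

theorem measurable_nodeDist_iSup (M : Network K) (s : Fin (K + 1)) (u : Plane)
    (Φ : Fin (K + 1) → RandomPoints Ω) (p : Fin (K + 1) × ℕ) :
    Measurable[⨆ k, (Φ k).sigma] (nodeDist M s u Φ p) :=
  (M.continuous_linkDist s p.1 u).measurable.comp
    (((Φ p.1).measurable_pt_sigma p.2).mono (le_iSup (fun k => (Φ k).sigma) p.1) le_rfl)

theorem measurable_nodeDist (M : Network K) (s : Fin (K + 1)) (u : Plane)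
    (Φ : Fin (K + 1) → RandomPoints Ω) (p : Fin (K + 1) × ℕ) : Measurable (nodeDist M s u Φ p) :=
  (measurable_nodeDist_iSup M s u Φ p).mono (iSup_sigma_le Φ) le_rfl

theorem measurableSet_isNode_iSup (Φ : Fin (K + 1) → RandomPoints Ω) (p : Fin (K + 1) × ℕ) :
    MeasurableSet[⨆ k, (Φ k).sigma] {ω | IsNode Φ p ω} :=
  le_iSup (fun k => (Φ k).sigma) p.1 _ ((Φ p.1).measurableSet_lt_num_sigma p.2)

theorem measurableSet_isNode (Φ : Fin (K + 1) → RandomPoints Ω) (p : Fin (K + 1) × ℕ) :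
    MeasurableSet {ω | IsNode Φ p ω} :=
  iSup_sigma_le Φ _ (measurableSet_isNode_iSup Φ p)

theorem nodeDist_nonneg (p : Fin (K + 1) × ℕ) (ω : Ω) : 0 ≤ nodeDist M s u Φ p ω :=
  M.linkDist_nonneg _ _ _ _

theorem nodeLinkProb_mem (p : Fin (K + 1) × ℕ) (c : Channel) (ω : Ω) :
    M.linkProb o s p.1 c (nodeDist M s u Φ p ω) ∈ Set.Icc (0 : ℝ) 1 :=
  M.linkProb_mem o s p.1 c (M.gap_le_linkDist s p.1 u _)

theorem measurable_nodeLinkProb (p : Fin (K + 1) × ℕ) (c : Channel) :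
    Measurable fun ω => M.linkProb o s p.1 c (nodeDist M s u Φ p ω) :=
  (M.measurable_linkProb o s p.1 c).comp (measurable_nodeDist M s u Φ p)

/-- If `p` is a node, its distance exceeds the threshold `v` of its layer and channel. -/
def Beyond (M : Network K) (s : Fin (K + 1)) (u : Plane) (Φ : Fin (K + 1) → RandomPoints Ω)
    (state : Fin (K + 1) × ℕ → Ω → Channel) (v : Fin (K + 1) × Channel → ℝ)
    (p : Fin (K + 1) × ℕ) (ω : Ω) : Prop :=
  IsNode Φ p ω → v (p.1, state p ω) < nodeDist M s u Φ p ω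

theorem IsLinkState.measurableSet_beyond (h : IsLinkState M o s u Φ state P)
    (v : Fin (K + 1) × Channel → ℝ) (p : Fin (K + 1) × ℕ) :
    MeasurableSet {ω | Beyond M s u Φ state v p ω} := by
  have : {ω | Beyond M s u Φ state v p ω} = {ω | IsNode Φ p ω}ᶜ ∪
      ⋃ c, {ω | state p ω = c} ∩ {ω | v (p.1, c) < nodeDist M s u Φ p ω} := by
    ext ω
    simp [Beyond, imp_iff_not_or]
  rw [this]
  exact (measurableSet_isNode Φ p).compl.union (MeasurableSet.iUnion fun c =>
    (h.measurable p c).inter (measurableSet_lt measurable_const (measurable_nodeDist M s u Φ p)))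

theorem IsLinkState.measurableSet_states (h : IsLinkState M o s u Φ state P)
    (S : Finset (Fin (K + 1) × ℕ)) (γ : Fin (K + 1) × ℕ → Channel) :
    MeasurableSet {ω | ∀ p ∈ S, state p ω = γ p} := by
  have : {ω | ∀ p ∈ S, state p ω = γ p} = ⋂ p ∈ S, {ω | state p ω = γ p} := by
    ext; simp
  rw [this]
  exact Finset.measurableSet_biInter _ fun p _ => h.measurable p _

/-- This integrates the conditional probability over `G`, which depends on the locations only and on
which all indices of `S` are nodes. -/
theorem IsLinkState.measureReal_inter_states [IsProbabilityMeasure P]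
    (h : IsLinkState M o s u Φ state P)
    (S : Finset (Fin (K + 1) × ℕ)) (γ : Fin (K + 1) × ℕ → Channel) {G : Set Ω}
    (hG : MeasurableSet[⨆ k, (Φ k).sigma] G) (hGS : ∀ ω ∈ G, ∀ p ∈ S, IsNode Φ p ω) :
    P.real (G ∩ {ω | ∀ p ∈ S, state p ω = γ p}) =
      ∫ ω in G, ∏ p ∈ S, M.linkProb o s p.1 (γ p) (nodeDist M s u Φ p ω) ∂P := by
  have hm := h.measurableSet_states S γ
  rw [← setIntegral_congr_ae (f := P[Set.indicator {ω' | ∀ p ∈ S, state p ω' = γ p}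
      (fun _ => (1 : ℝ)) | ⨆ k, (Φ k).sigma]) (iSup_sigma_le Φ _ hG)
      ((h.cond S γ).mono fun ω hω hωG => hω (hGS ω hωG)),
    setIntegral_condExp (iSup_sigma_le Φ) ((integrable_const _).indicator hm) hG,
    setIntegral_indicator hm, setIntegral_const, smul_eq_mul, mul_one]

theorem integrable_prod_nodeLinkProb_mul_prod_mark [IsProbabilityMeasure P]
    (S T : Finset (Fin (K + 1) × ℕ)) (γ : Fin (K + 1) × ℕ → Channel)
    (v : Fin (K + 1) × Channel → ℝ) :
    Integrable (fun ω => (∏ p ∈ S, M.linkProb o s p.1 (γ p) (nodeDist M s u Φ p ω)) *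
      ∏ p ∈ T, (Φ p.1).mark (M.beyondProb o s p.1 u v) p.2 ω) P := by
  have h1 := fun p ω => nodeLinkProb_mem (M := M) (o := o) (s := s) (u := u) (Φ := Φ) p (γ p) ω
  have h2 := fun (p : Fin (K + 1) × ℕ) ω =>
    (Φ p.1).mark_mem (M.beyondProb_mem o s p.1 u v) p.2 ω
  refine Integrable.of_mem_Icc 0 1 (Measurable.mul
    (Finset.measurable_fun_prod _ fun p _ => measurable_nodeLinkProb p _)
    (Finset.measurable_fun_prod _ fun p _ =>
      (Φ p.1).measurable_mark (M.measurable_beyondProb o s p.1 u v) p.2)).aemeasurable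
    (ae_of_all _ fun ω => ⟨mul_nonneg (Finset.prod_nonneg fun p _ => (h1 p ω).1)
      (Finset.prod_nonneg fun p _ => (h2 p ω).1), mul_le_one₀
      (Finset.prod_le_one (fun p _ => (h1 p ω).1) fun p _ => (h1 p ω).2)
      (Finset.prod_nonneg fun p _ => (h2 p ω).1)
      (Finset.prod_le_one (fun p _ => (h2 p ω).1) fun p _ => (h2 p ω).2)⟩)

/-- Induction on `T`, with `S`, `γ` and `G` kept general. Where the new index `p` is not a node, its
condition is void and its mark is one. Where it is a node, each possible state `c` is treated by
moving `p` into `S` with prescribed state `c` and shrinking `G` by the distance condition, which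
depends on the locations only. Adding over `c` rebuilds `beyondProb`. -/
theorem IsLinkState.measureReal_inter_states_inter_beyond [IsProbabilityMeasure P]
    (h : IsLinkState M o s u Φ state P) (v : Fin (K + 1) × Channel → ℝ)
    (T : Finset (Fin (K + 1) × ℕ)) :
    ∀ (S : Finset (Fin (K + 1) × ℕ)) (γ : Fin (K + 1) × ℕ → Channel) (G : Set Ω),
      Disjoint S T → MeasurableSet[⨆ k, (Φ k).sigma] G → (∀ ω ∈ G, ∀ p ∈ S, IsNode Φ p ω) →
      P.real (G ∩ {ω | ∀ p ∈ S, state p ω = γ p} ∩ {ω | ∀ p ∈ T, Beyond M s u Φ state v p ω}) =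
        ∫ ω in G, (∏ p ∈ S, M.linkProb o s p.1 (γ p) (nodeDist M s u Φ p ω)) *
          ∏ p ∈ T, (Φ p.1).mark (M.beyondProb o s p.1 u v) p.2 ω ∂P := by
  induction T using Finset.induction_on with
  | empty =>
    intro S γ G _ hG hGS
    simpa using h.measureReal_inter_states S γ hG hGS
  | insert p T hp ih =>
    intro S γ G hST hG hGS
    rw [Finset.disjoint_insert_right] at hST
    obtain ⟨hpS, hST⟩ := hST
    let N : Set Ω := {ω | IsNode Φ p ω}
    let D : Channel → Set Ω := fun c => {ω | v (p.1, c) < nodeDist M s u Φ p ω}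
    have hN : MeasurableSet[⨆ k, (Φ k).sigma] N := measurableSet_isNode_iSup Φ p
    have hD : ∀ c, MeasurableSet[⨆ k, (Φ k).sigma] (D c) := fun c =>
      measurableSet_lt measurable_const (measurable_nodeDist_iSup M s u Φ p)
    have hNm := iSup_sigma_le Φ _ hN
    have hDm := fun c => iSup_sigma_le Φ _ (hD c)
    have hGm := iSup_sigma_le Φ _ hG
    let E := G ∩ {ω | ∀ p ∈ S, state p ω = γ p} ∩
      {ω | ∀ q ∈ insert p T, Beyond M s u Φ state v q ω}
    -- the part of the event where `p` is not a node
    have hnot : P.real (E \ N) = ∫ ω in G \ N,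
        (∏ p ∈ S, M.linkProb o s p.1 (γ p) (nodeDist M s u Φ p ω)) *
          ∏ q ∈ insert p T, (Φ q.1).mark (M.beyondProb o s q.1 u v) q.2 ω ∂P := by
      rw [setIntegral_congr_fun (hGm.diff hNm) (g := fun ω =>
        (∏ p ∈ S, M.linkProb o s p.1 (γ p) (nodeDist M s u Φ p ω)) *
          ∏ p ∈ T, (Φ p.1).mark (M.beyondProb o s p.1 u v) p.2 ω),
        ← ih S γ (G \ N) hST (hG.diff hN) (fun ω hω => hGS ω hω.1)]
      · congr 1
        ext ω
        simp only [E, N, Set.mem_inter_iff, Set.mem_sdiff, Set.mem_ofPred_eq,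
          Finset.forall_mem_insert, Beyond]
        tauto
      · intro ω hω
        have : (Φ p.1).mark (M.beyondProb o s p.1 u v) p.2 ω = 1 := if_neg hω.2
        simp only [Finset.prod_insert hp, this, one_mul]
    -- the part of the event where `p` is a node in channel `c`
    have hnode : ∀ c, P.real (E ∩ N ∩ {ω | state p ω = c}) = ∫ ω in G ∩ N, (D c).indicator
        (fun ω => M.linkProb o s p.1 c (nodeDist M s u Φ p ω) *
          ((∏ p ∈ S, M.linkProb o s p.1 (γ p) (nodeDist M s u Φ p ω)) *
            ∏ p ∈ T, (Φ p.1).mark (M.beyondProb o s p.1 u v) p.2 ω)) ω ∂P := by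
      intro c
      rw [setIntegral_indicator (hDm c)]
      have key := ih (insert p S) (Function.update γ p c) (G ∩ N ∩ D c)
        (Finset.disjoint_insert_left.2 ⟨hp, hST⟩) ((hG.inter hN).inter (hD c))
        (fun ω hω => by
          rw [Finset.forall_mem_insert]
          exact ⟨hω.1.2, hGS ω hω.1.1⟩)
      have hupd : ∀ q ∈ S, Function.update γ p c q = γ q := fun q hq =>
        Function.update_of_ne (fun hqp : q = p => hpS (by rwa [← hqp])) _ _
      have hprod : ∀ ω, ∏ q ∈ insert p S, M.linkProb o s q.1 (Function.update γ p c q)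
          (nodeDist M s u Φ q ω) = M.linkProb o s p.1 c (nodeDist M s u Φ p ω) *
            ∏ q ∈ S, M.linkProb o s q.1 (γ q) (nodeDist M s u Φ q ω) := by
        intro ω
        rw [Finset.prod_insert hpS, Function.update_self]
        congr 1
        exact Finset.prod_congr rfl fun q hq => by rw [hupd q hq]
      simp_rw [hprod, mul_assoc] at key
      rw [← key]
      congr 1
      ext ω
      simp only [E, N, D, Set.mem_inter_iff, Set.mem_ofPred_eq, Finset.forall_mem_insert, Beyond,
        Function.update_self]
      have : (∀ q ∈ S, state q ω = Function.update γ p c q) ↔ ∀ q ∈ S, state q ω = γ q :=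
        forall₂_congr fun q hq => by rw [hupd q hq]
      rw [this]
      constructor
      · rintro ⟨⟨⟨⟨hg, hs⟩, hp, ht⟩, hn⟩, rfl⟩
        exact ⟨⟨⟨⟨hg, hn⟩, hp hn⟩, rfl, hs⟩, ht⟩
      · rintro ⟨⟨⟨⟨hg, hn⟩, hp⟩, rfl, hs⟩, ht⟩
        exact ⟨⟨⟨⟨hg, hs⟩, fun _ => hp, ht⟩, hn⟩, rfl⟩
    have hint := integrable_prod_nodeLinkProb_mul_prod_mark (M := M) (o := o) (s := s) (u := u)
      (Φ := Φ) (P := P) S (insert p T) γ v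
    have hint' : ∀ c, Integrable (fun ω => M.linkProb o s p.1 c (nodeDist M s u Φ p ω) *
        ((∏ p ∈ S, M.linkProb o s p.1 (γ p) (nodeDist M s u Φ p ω)) *
          ∏ p ∈ T, (Φ p.1).mark (M.beyondProb o s p.1 u v) p.2 ω)) P := fun c =>
      (integrable_prod_nodeLinkProb_mul_prod_mark S T γ v).bdd_mul (c := 1)
        (measurable_nodeLinkProb p c).aestronglyMeasurable (ae_of_all _ fun ω => by
          have := nodeLinkProb_mem (M := M) (o := o) (s := s) (u := u) (Φ := Φ) p c ω
          rw [Real.norm_eq_abs, abs_of_nonneg this.1]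
          exact this.2)
    have hsplit : P.real (E ∩ N) = P.real (E ∩ N ∩ {ω | state p ω = .los}) +
        P.real (E ∩ N ∩ {ω | state p ω = .nlos}) := by
      rw [← measureReal_inter_add_sdiff (s := E ∩ N) (h.measurable p .los)]
      congr 2
      ext ω
      simp only [Set.mem_sdiff, Set.mem_inter_iff, Set.mem_ofPred_eq]
      cases state p ω <;> simp
    change P.real E = _
    rw [← measureReal_inter_add_sdiff (s := E) hNm, ← integral_inter_add_sdiff hNm hint.integrableOn,
      hnot, hsplit, hnode, hnode, ← integral_add
        ((hint' _).indicator (hDm _)).integrableOn ((hint' _).indicator (hDm _)).integrableOn]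
    congr 1
    refine setIntegral_congr_fun (hGm.inter hNm) fun ω hω => ?_
    have : (Φ p.1).mark (M.beyondProb o s p.1 u v) p.2 ω =
        ∑ c, if v (p.1, c) < nodeDist M s u Φ p ω then
          M.linkProb o s p.1 c (nodeDist M s u Φ p ω) else 0 := if_pos hω.2
    simp only [Finset.prod_insert hp, this, Channel.sum_univ, Set.indicator_apply, D,
      Set.mem_ofPred_eq]
    split_ifs <;> ring

theorem IsLinkState.measureReal_beyond [IsProbabilityMeasure P]
    (h : IsLinkState M o s u Φ state P) (v : Fin (K + 1) × Channel → ℝ)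
    (T : Finset (Fin (K + 1) × ℕ)) :
    P.real {ω | ∀ p ∈ T, Beyond M s u Φ state v p ω} =
      ∫ ω, ∏ p ∈ T, (Φ p.1).mark (M.beyondProb o s p.1 u v) p.2 ω ∂P := by
  have := h.measureReal_inter_states_inter_beyond v T ∅ (fun _ => .los) Set.univ
    (Finset.disjoint_empty_left _) MeasurableSet.univ (by simp)
  simpa using this

/-- Probability that all nodes are beyond the thresholds of their layers and channels. -/
theorem IsLinkState.measureReal_forall_beyond [IsProbabilityMeasure P]
    (h : IsLinkState M o s u Φ state P)
    (hΦ : ∀ k, (Φ k).IsPoisson P (M.density o.candidates k))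
    (hindep : iIndep (fun k => (Φ k).sigma) P) (v : Fin (K + 1) × Channel → ℝ) :
    P.real {ω | ∀ p, Beyond M s u Φ state v p ω} =
      ∏ k, Real.exp (-(M.density o.candidates k * ∫ x, (1 - M.beyondProb o s k u v x))) := by
  -- Only the first `N` indices of every layer are tested; these events decrease to the desired one.
  let B : ℕ → Set Ω := fun N =>
    {ω | ∀ p ∈ (Finset.univ : Finset (Fin (K + 1))) ×ˢ Finset.range N,
      Beyond M s u Φ state v p ω}
  have hB : ∀ N, MeasurableSet (B N) := fun N => by
    have : B N = ⋂ p ∈ (Finset.univ : Finset (Fin (K + 1))) ×ˢ Finset.range N,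
        {ω | Beyond M s u Φ state v p ω} := by
      ext; simp [B]
    rw [this]
    exact Finset.measurableSet_biInter _ fun p _ => h.measurableSet_beyond v p
  have hanti : Antitone B := fun N N' hN ω hω p hp => hω p (by
    simp only [Finset.mem_product, Finset.mem_univ, Finset.mem_range, true_and] at hp ⊢
    exact hp.trans_le hN)
  have hinter : ⋂ N, B N = {ω | ∀ p, Beyond M s u Φ state v p ω} := by
    ext ω
    simp only [B, Set.mem_iInter, Set.mem_ofPred_eq]
    exact ⟨fun hω p => hω (p.2 + 1) p (by simp), fun hω N p _ => hω p⟩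
  have h1 : Tendsto (fun N => P.real (B N)) atTop
      (𝓝 (P.real {ω | ∀ p, Beyond M s u Φ state v p ω})) := by
    rw [← hinter]
    exact (ENNReal.tendsto_toReal (measure_ne_top P _)).comp
      (tendsto_measure_iInter_atTop (fun N => (hB N).nullMeasurableSet) hanti
        ⟨0, measure_ne_top P _⟩)
  have h2 : ∀ N, P.real (B N) = ∏ k, ∫ ω, ∏ n ∈ Finset.range N,
      (Φ k).mark (M.beyondProb o s k u v) n ω ∂P := by
    intro N
    rw [h.measureReal_beyond v]
    simp_rw [Finset.prod_product]
    -- Once the states are integrated out, each layer's factor depends on that layer's locations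
    -- alone, so independence of the layers applies.
    have hmeas : ∀ k, Measurable[(Φ k).sigma] fun ω =>
        ∏ n ∈ Finset.range N, (Φ k).mark (M.beyondProb o s k u v) n ω := fun k =>
      Finset.measurable_fun_prod _ fun n _ =>
        (Φ k).measurable_mark_sigma (M.measurable_beyondProb o s k u v) n
    refine iIndepFun.integral_fun_prod_eq_prod_integral ((iIndepFun_iff_iIndep _ _ _).2
      (iIndep_of_iIndep_of_le hindep fun k => (hmeas k).comap_le)) fun k => ?_
    exact ((hmeas k).mono (Φ k).sigma_le le_rfl).aestronglyMeasurable
  refine tendsto_nhds_unique h1 ?_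
  simp_rw [h2]
  refine tendsto_finsetProd _ fun k _ => ?_
  obtain ⟨R, hR⟩ := M.exists_beyondProb_eq_one o s k u v
  exact (hΦ k).tendsto_integral_prod_mark (M.measurable_beyondProb o s k u v)
    (M.beyondProb_mem o s k u v) Metric.isClosed_closedBall.measurableSet
    measure_closedBall_lt_top.ne hR

end Thinning

/-! ### Distance densities and polar coordinates -/

/-- Fundamental theorem of calculus for the exponential of the primitive of a bounded function. -/
theorem intervalIntegral_mul_exp_neg {r : ℝ → ℝ} {a b C : ℝ} (hab : a ≤ b) (hr : Measurable r)
    (hr0 : ∀ x ∈ Set.Icc a b, r x ∈ Set.Icc 0 C) :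
    ∫ x in a..b, r x * Real.exp (-∫ y in a..x, r y) = 1 - Real.exp (-∫ y in a..b, r y) := by
  have hC : ∀ x ∈ Set.Icc a b, ‖r x‖ ≤ C := fun x hx => by
    rw [Real.norm_eq_abs, abs_of_nonneg (hr0 x hx).1]; exact (hr0 x hx).2
  have hint : IntervalIntegrable r volume a b := by
    rw [intervalIntegrable_iff_integrableOn_Icc_of_le hab]
    exact IntegrableOn.of_bound measure_Icc_lt_top hr.aestronglyMeasurable C
      ((ae_restrict_iff' measurableSet_Icc).2 (ae_of_all _ hC))
  have hsub : ∀ x ∈ Set.Icc a b, ∀ y ∈ Set.Icc a b, IntervalIntegrable r volume x y :=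
    fun x hx y hy => hint.mono_set (by
      rw [Set.uIcc_of_le hab]; exact Set.uIcc_subset_Icc hx hy)
  have hL0 : ∀ x ∈ Set.Icc a b, 0 ≤ ∫ y in a..x, r y := fun x hx =>
    intervalIntegral.integral_nonneg hx.1 fun y hy => (hr0 y ⟨hy.1, hy.2.trans hx.2⟩).1
  have hC0 : 0 ≤ C := (norm_nonneg _).trans (hC a ⟨le_rfl, hab⟩)
  have hexp : ∀ p q : ℝ, 0 ≤ p → p ≤ q → |Real.exp (-q) - Real.exp (-p)| ≤ q - p := by
    intro p q hp hpq
    have h1 : Real.exp (-q) ≤ Real.exp (-p) := Real.exp_le_exp.2 (by linarith)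
    rw [abs_sub_comm, abs_of_nonneg (by linarith)]
    have h2 : Real.exp (-q) = Real.exp (-p) * Real.exp (-(q - p)) := by
      rw [← Real.exp_add]; ring_nf
    have h3 := Real.add_one_le_exp (-(q - p))
    have h4 : Real.exp (-p) ≤ 1 := Real.exp_le_one_iff.2 (by linarith)
    have h5 := Real.exp_pos (-p)
    rw [h2]
    nlinarith
  -- The rate `r` is merely measurable, so its primitive is differentiable only almost everywhere.
  -- The Lipschitz bound gives absolute continuity, for which the fundamental theorem still holds;
  -- `exp (-·)` is 1-Lipschitz on the nonnegative reals.
  have hlip : LipschitzOnWith C.toNNReal (fun x => Real.exp (-∫ y in a..x, r y))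
      (Set.uIcc a b) := by
    rw [Set.uIcc_of_le hab]
    refine LipschitzOnWith.of_le_add_mul _ fun x hx y hy => ?_
    have h1 : |Real.exp (-∫ y in a..x, r y) - Real.exp (-∫ z in a..y, r z)| ≤
        |(∫ y in a..x, r y) - ∫ z in a..y, r z| := by
      rcases le_total (∫ y in a..x, r y) (∫ z in a..y, r z) with h | h
      · rw [abs_sub_comm, abs_sub_comm (∫ y in a..x, r y)]
        exact (hexp _ _ (hL0 x hx) h).trans (le_abs_self _)
      · exact (hexp _ _ (hL0 y hy) h).trans (le_abs_self _)
    have h2 : |(∫ y in a..x, r y) - ∫ z in a..y, r z| ≤ C * |x - y| := by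
      rw [intervalIntegral.integral_interval_sub_left (hsub a ⟨le_rfl, hab⟩ x hx)
        (hsub a ⟨le_rfl, hab⟩ y hy), ← Real.norm_eq_abs]
      refine intervalIntegral.norm_integral_le_of_norm_le_const fun z hz => hC z ?_
      exact Set.uIcc_subset_Icc hy hx (Set.uIoc_subset_uIcc hz)
    rw [Real.coe_toNNReal C hC0, Real.dist_eq]
    linarith [(abs_le.1 (h1.trans h2)).2]
  have key := hlip.absolutelyContinuousOnInterval.integral_deriv_eq_sub
  rw [intervalIntegral.integral_same, neg_zero, Real.exp_zero] at key
  have hder : ∫ x in a..b, r x * Real.exp (-∫ y in a..x, r y) =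
      ∫ x in a..b, -deriv (fun x => Real.exp (-∫ y in a..x, r y)) x := by
    refine intervalIntegral.integral_congr_ae ?_
    filter_upwards [hint.ae_hasDerivAt_integral] with x hx hxab
    have := ((hx (Set.uIoc_subset_uIcc hxab) a Set.left_mem_uIcc).neg.exp).deriv
    simp only [Pi.neg_apply] at this
    rw [this]
    ring
  rw [hder, intervalIntegral.integral_neg, key]
  ring

/-- Substitution `r = √(y² + h²)`, for which `r dr = y dy`. -/
theorem integral_Ioi_comp_sqrt {h : ℝ} (hh : 0 ≤ h) (f : ℝ → ℝ) :
    ∫ y in Set.Ioi (0 : ℝ), y * f √(y ^ 2 + h ^ 2) = ∫ r in Set.Ioi h, r * f r := by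
  have himg : (fun y : ℝ => √(y ^ 2 + h ^ 2)) '' Set.Ioi 0 = Set.Ioi h := by
    ext r
    simp only [Set.mem_image, Set.mem_Ioi]
    constructor
    · rintro ⟨y, hy, rfl⟩
      exact Real.lt_sqrt_of_sq_lt (by nlinarith)
    · intro hr
      refine ⟨√(r ^ 2 - h ^ 2), Real.sqrt_pos.2 (by nlinarith), ?_⟩
      rw [Real.sq_sqrt (by nlinarith), sub_add_cancel, Real.sqrt_sq (by linarith)]
  have hpos : ∀ y ∈ Set.Ioi (0 : ℝ), 0 < y ^ 2 + h ^ 2 := fun y hy => by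
    have : 0 < y := hy
    positivity
  rw [← himg, integral_image_eq_integral_abs_deriv_smul measurableSet_Ioi
    (f' := fun y => y / √(y ^ 2 + h ^ 2))]
  · refine setIntegral_congr_fun measurableSet_Ioi fun y hy => ?_
    have hs := Real.sqrt_pos.2 (hpos y hy)
    have hy' : (0 : ℝ) < y := hy
    simp only [smul_eq_mul]
    rw [abs_of_nonneg (by positivity)]
    field_simp
  · intro y hy
    have := ((hasDerivAt_pow 2 y).add_const (h ^ 2)).sqrt (hpos y hy).ne'
    rw [show ((2 : ℕ) : ℝ) * y ^ (2 - 1) / (2 * √(y ^ 2 + h ^ 2)) = y / √(y ^ 2 + h ^ 2) by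
      rw [Nat.cast_ofNat, pow_one, mul_div_mul_left _ _ two_ne_zero]] at this
    exact this.hasDerivWithinAt
  · intro x hx y hy hxy
    have hx' : (0 : ℝ) < x := hx
    have hy' : (0 : ℝ) < y := hy
    have := (Real.sqrt_inj (hpos x hx).le (hpos y hy).le).1 hxy
    nlinarith

namespace Network

variable {K : ℕ} (M : Network K) (o : Subject) (s k : Fin (K + 1)) (u : Plane) (c : Channel)

/-- Translate `u` to the origin, pass to polar coordinates in the plane, and replace the horizontal
distance by the link length. -/
theorem integral_comp_linkDist (f : ℝ → ℝ) :
    ∫ x, f (M.linkDist s u k x) = 2 * Real.pi * ∫ r in Set.Ioi (M.gap s k), r * f r := by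
  simp_rw [linkDist_eq_sqrt]
  rw [integral_sub_right_eq_self (fun x : Plane => f √(‖x‖ ^ 2 + M.gap s k ^ 2)) u,
    integral_fun_norm_addHaar volume (fun y => f √(y ^ 2 + M.gap s k ^ 2)),
    ← integral_Ioi_comp_sqrt (M.gap_nonneg s k)]
  simp only [finrank_euclideanSpace, Fintype.card_fin, measureReal_def,
    EuclideanSpace.volume_ball, smul_eq_mul]
  have : (ENNReal.ofReal 1 ^ 2 * ENNReal.ofReal (√Real.pi ^ 2 / Real.Gamma ((2 : ℕ) / 2 + 1))).toReal
      = Real.pi := by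
    rw [Real.sq_sqrt Real.pi_pos.le]
    norm_num [Real.Gamma_two, Real.pi_pos.le]
  rw [this]
  simp
  ring

/-- Intensity, with respect to the distance, of the `k`-layer candidates in channel `c`. -/
def intensity (x : ℝ) : ℝ :=
  2 * Real.pi * (M.density o.candidates k : ℝ) * x * M.linkProb o s k c x

theorem measurable_intensity : Measurable (M.intensity o s k c) :=
  (measurable_id.const_mul _).mul (M.measurable_linkProb o s k c)

theorem intensity_mem {x : ℝ} (hx : M.gap s k ≤ x) : M.intensity o s k c x ∈
    Set.Icc 0 (2 * Real.pi * (M.density o.candidates k : ℝ) * x) := by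
  have h1 := M.linkProb_mem o s k c hx
  have h2 := (M.gap_nonneg s k).trans hx
  have h3 : 0 ≤ 2 * Real.pi * (M.density o.candidates k : ℝ) * x := by positivity
  exact ⟨mul_nonneg h3 h1.1, mul_le_of_le_one_right h3 h1.2⟩

theorem intensity_mem_of_mem {b x : ℝ} (hx : x ∈ Set.Icc (M.gap s k) b) :
    M.intensity o s k c x ∈ Set.Icc 0 (2 * Real.pi * (M.density o.candidates k : ℝ) * b) := by
  refine ⟨(M.intensity_mem o s k c hx.1).1, (M.intensity_mem o s k c hx.1).2.trans ?_⟩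
  exact mul_le_mul_of_nonneg_left hx.2 (by positivity)

theorem intervalIntegrable_intensity {b : ℝ} (hb : M.gap s k ≤ b) :
    IntervalIntegrable (M.intensity o s k c) volume (M.gap s k) b := by
  rw [intervalIntegrable_iff_integrableOn_Icc_of_le hb]
  refine IntegrableOn.of_bound measure_Icc_lt_top
    (M.measurable_intensity o s k c).aestronglyMeasurable
    (2 * Real.pi * (M.density o.candidates k : ℝ) * b)
    ((ae_restrict_iff' measurableSet_Icc).2 (ae_of_all _ fun x hx => ?_))
  have := M.intensity_mem_of_mem o s k c hx
  rw [Real.norm_eq_abs, abs_of_nonneg this.1]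
  exact this.2

theorem nearestCCDF_eq (v : ℝ) : M.nearestCCDF o s k c v =
    Real.exp (-∫ x in (M.gap s k)..(max v (M.gap s k)), M.intensity o s k c x) := rfl

theorem nearestCCDF_nonneg (v : ℝ) : 0 ≤ M.nearestCCDF o s k c v := (Real.exp_pos _).le

theorem nearestCCDF_of_neg {v : ℝ} (hv : v < 0) : M.nearestCCDF o s k c v = 1 := by
  rw [nearestCCDF_eq, max_eq_right (hv.le.trans (M.gap_nonneg s k))]
  simp

theorem continuous_nearestCCDF : Continuous (M.nearestCCDF o s k c) := by
  -- Below the gap the state probabilities are unconstrained, so the intensity need not be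
  -- integrable there. Truncating it to zero leaves the CCDF unchanged.
  let g : ℝ → ℝ := (Set.Ici (M.gap s k)).indicator (M.intensity o s k c)
  have hg : ∀ b, M.gap s k ≤ b → ∫ x in (M.gap s k)..b, M.intensity o s k c x =
      ∫ x in (M.gap s k)..b, g x := fun b hb =>
    intervalIntegral.integral_congr fun x hx => by
      rw [Set.uIcc_of_le hb] at hx
      exact (Set.indicator_of_mem (Set.mem_Ici.2 hx.1) _).symm
  have hgint : ∀ a b, IntervalIntegrable g volume a b := by
    have h1 : ∀ b, IntervalIntegrable g volume (M.gap s k) b := by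
      intro b
      rcases le_total (M.gap s k) b with hb | hb
      · exact (M.intervalIntegrable_intensity o s k c hb).congr fun x hx => by
          rw [Set.uIoc_of_le hb] at hx
          exact (Set.indicator_of_mem (Set.mem_Ici.2 hx.1.le) _).symm
      · refine IntervalIntegrable.symm ?_
        rw [intervalIntegrable_iff_integrableOn_Ioo_of_le hb]
        exact integrableOn_zero.congr_fun (fun x hx =>
          (Set.indicator_of_notMem (by simpa using hx.2) _).symm) measurableSet_Ioo
    exact fun a b => (h1 a).symm.trans (h1 b)
  have : M.nearestCCDF o s k c =
      fun v => Real.exp (-∫ x in (M.gap s k)..(max v (M.gap s k)), g x) := by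
    ext v
    rw [nearestCCDF_eq, hg _ (le_max_right _ _)]
  rw [this]
  exact Real.continuous_exp.comp ((intervalIntegral.continuous_primitive hgint _).comp
    (continuous_id.max continuous_const)).neg

theorem nearestPDF_eq (v : ℝ) : M.nearestPDF o s k c v =
    if v < M.gap s k then 0 else M.intensity o s k c v * M.nearestCCDF o s k c v := by
  rw [nearestPDF, nearestCCDF]
  split_ifs with h
  · rfl
  · rw [max_eq_left (not_lt.1 h), intensity]

theorem measurable_nearestPDF : Measurable (M.nearestPDF o s k c) := by
  simp_rw [funext (M.nearestPDF_eq o s k c)]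
  exact Measurable.ite measurableSet_Iio measurable_const
    ((M.measurable_intensity o s k c).mul (M.continuous_nearestCCDF o s k c).measurable)

theorem nearestPDF_nonneg (v : ℝ) : 0 ≤ M.nearestPDF o s k c v := by
  rw [nearestPDF_eq]
  split_ifs with h
  · exact le_rfl
  · exact mul_nonneg (M.intensity_mem o s k c (not_lt.1 h)).1 (M.nearestCCDF_nonneg o s k c v)

theorem nearestPDF_of_lt {v : ℝ} (hv : v < M.gap s k) : M.nearestPDF o s k c v = 0 := if_pos hv

/-- Below the gap both sides vanish. Above it the density has the form `r exp (-∫ r)`, with `r`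
bounded on each bounded interval. -/
theorem setLIntegral_nearestPDF_Iic (v : ℝ) :
    ∫⁻ x in Set.Iic v, ENNReal.ofReal (M.nearestPDF o s k c x) =
      ENNReal.ofReal (1 - M.nearestCCDF o s k c v) := by
  rcases lt_or_ge v (M.gap s k) with hv | hv
  · rw [nearestCCDF_eq, max_eq_right hv.le, setLIntegral_congr_fun measurableSet_Iic
      (g := fun _ => 0) fun x hx => by
        simp only [M.nearestPDF_of_lt o s k c (lt_of_le_of_lt hx hv), ENNReal.ofReal_zero]]
    simp
  · have hsplit : Set.Iic v = Set.Iio (M.gap s k) ∪ Set.Icc (M.gap s k) v := by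
      ext x; simp only [Set.mem_Iic, Set.mem_union, Set.mem_Iio, Set.mem_Icc]
      constructor
      · intro h
        rcases lt_or_ge x (M.gap s k) with h' | h'
        · exact Or.inl h'
        · exact Or.inr ⟨h', h⟩
      · rintro (h | h)
        · linarith
        · exact h.2
    have hd : Disjoint (Set.Iio (M.gap s k)) (Set.Icc (M.gap s k) v) :=
      Set.disjoint_left.2 fun x hx hx' => not_le.2 hx hx'.1
    rw [hsplit, lintegral_union measurableSet_Icc hd, setLIntegral_congr_fun measurableSet_Iio
      (g := fun _ => 0) fun x hx => by
        simp only [M.nearestPDF_of_lt o s k c hx, ENNReal.ofReal_zero]]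
    have hb : ∀ x ∈ Set.Icc (M.gap s k) v, M.nearestPDF o s k c x =
        M.intensity o s k c x * Real.exp (-∫ y in (M.gap s k)..x, M.intensity o s k c y) := by
      intro x hx
      rw [nearestPDF_eq, if_neg (not_lt.2 hx.1), nearestCCDF_eq, max_eq_left hx.1]
    have hint : IntegrableOn (M.nearestPDF o s k c) (Set.Icc (M.gap s k) v) := by
      refine IntegrableOn.of_bound measure_Icc_lt_top
        (M.measurable_nearestPDF o s k c).aestronglyMeasurable
        (2 * Real.pi * (M.density o.candidates k : ℝ) * v)
        ((ae_restrict_iff' measurableSet_Icc).2 (ae_of_all _ fun x hx => ?_))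
      have h1 := M.intensity_mem_of_mem o s k c hx
      rw [Real.norm_eq_abs, abs_of_nonneg (M.nearestPDF_nonneg o s k c x), hb x hx]
      refine (mul_le_of_le_one_right h1.1 (Real.exp_le_one_iff.2 ?_)).trans h1.2
      rw [neg_nonpos]
      exact intervalIntegral.integral_nonneg hx.1 fun y hy =>
        (M.intensity_mem o s k c hy.1).1
    rw [lintegral_zero, zero_add, ← ofReal_integral_eq_lintegral_ofReal hint
      (ae_of_all _ (M.nearestPDF_nonneg o s k c)), integral_Icc_eq_integral_Ioc,
      ← intervalIntegral.integral_of_le hv, nearestCCDF_eq, max_eq_left hv,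
      ← intervalIntegral_mul_exp_neg hv (M.measurable_intensity o s k c)
        fun x hx => M.intensity_mem_of_mem o s k c hx]
    congr 1
    refine intervalIntegral.integral_congr fun x hx => ?_
    rw [Set.uIcc_of_le hv] at hx
    exact hb x hx

/-- The integrand `1 - beyondProb` is a sum over the link states, so the exponential factors. This
is why the line-of-sight and non-line-of-sight distances within a layer are independent. -/
theorem exp_neg_integral_one_sub_beyondProb (v : Fin (K + 1) × Channel → ℝ) :
    Real.exp (-(M.density o.candidates k * ∫ x, (1 - M.beyondProb o s k u v x))) =
      ∏ c, M.nearestCCDF o s k c (v (k, c)) := by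
  have hset : ∀ b, Set.Ioi (M.gap s k) ∩ Set.Iic b =
      Set.Ioc (M.gap s k) (max b (M.gap s k)) := by
    intro b
    ext x
    simp only [Set.mem_inter_iff, Set.mem_Ioi, Set.mem_Iic, Set.mem_Ioc, le_max_iff]
    exact ⟨fun h => ⟨h.1, Or.inl h.2⟩, fun h => ⟨h.1, h.2.resolve_right (not_le.2 h.1)⟩⟩
  have hint : ∀ c, IntegrableOn ((Set.Iic (v (k, c))).indicator (M.intensity o s k c))
      (Set.Ioi (M.gap s k)) := fun c => by
    rw [IntegrableOn, integrable_indicator_iff measurableSet_Iic, IntegrableOn,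
      Measure.restrict_restrict measurableSet_Iic, Set.inter_comm, hset]
    exact (M.intervalIntegrable_intensity o s k c (le_max_right _ _)).1
  have hmain : (M.density o.candidates k : ℝ) * ∫ x, (1 - M.beyondProb o s k u v x) =
      ∑ c, ∫ x in (M.gap s k)..(max (v (k, c)) (M.gap s k)), M.intensity o s k c x := by
    simp_rw [one_sub_beyondProb]
    rw [M.integral_comp_linkDist s k u
      (fun d => ∑ c, if d ≤ v (k, c) then M.linkProb o s k c d else 0), ← integral_const_mul,
      ← integral_const_mul]
    trans ∫ x in Set.Ioi (M.gap s k),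
        ∑ c, (Set.Iic (v (k, c))).indicator (M.intensity o s k c) x
    · congr 1
      ext x
      simp only [Finset.mul_sum, Set.indicator_apply, Set.mem_Iic, intensity]
      refine Finset.sum_congr rfl fun c _ => ?_
      split_ifs <;> ring
    · rw [integral_finsetSum _ fun c _ => hint c]
      refine Finset.sum_congr rfl fun c _ => ?_
      rw [setIntegral_indicator measurableSet_Iic, hset,
        intervalIntegral.integral_of_le (le_max_right _ _)]
  rw [hmain, ← Finset.sum_neg_distrib, Real.exp_sum]
  rfl

end Network

/-! ### Joint law of the nearest-node distances -/

theorem coe_lt_coe_ofReal_iff {v d : ℝ} (hd : 0 ≤ d) :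
    (v : EReal) < (ENNReal.ofReal d : EReal) ↔ v < d := by
  rw [EReal.coe_ennreal_ofReal, max_eq_left hd, EReal.coe_lt_coe_iff]

theorem ne_top_and_toReal_le_iff {x : ℝ≥0∞} {v : ℝ} :
    x ≠ ∞ ∧ x.toReal ≤ v ↔ ¬ (v : EReal) < (x : EReal) := by
  induction x with
  | top => simp
  | coe r =>
    have : ((r : ℝ≥0∞) : EReal) = ((r : ℝ) : EReal) := rfl
    rw [this, EReal.coe_lt_coe_iff]
    simp

/-- The extended nonnegative numbers that exceed a real number. -/
def exceeding (v : ℝ) : Set ℝ≥0∞ := {x | (v : EReal) < (x : EReal)}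

theorem exceeding_inter (v w : ℝ) : exceeding v ∩ exceeding w = exceeding (max v w) := by
  ext x
  simp only [exceeding, Set.mem_inter_iff, Set.mem_ofPred_eq,
    EReal.coe_strictMono.monotone.map_max, max_lt_iff]

theorem exceeding_of_neg {v : ℝ} (hv : v < 0) : exceeding v = Set.univ :=
  Set.eq_univ_of_forall fun x =>
    (EReal.coe_lt_coe_iff.2 hv : (v : EReal) < (0 : ℝ)).trans_le (EReal.coe_ennreal_nonneg x)

theorem measurableSet_exceeding (v : ℝ) : MeasurableSet (exceeding v) :=
  measurableSet_lt measurable_const measurable_coe_ennreal_ereal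

theorem measurableSpace_eq_generateFrom_exceeding :
    ENNReal.measurableSpace =
      MeasurableSpace.generateFrom (Set.range exceeding) := by
  refine le_antisymm ?_ (MeasurableSpace.generateFrom_le ?_)
  · rw [BorelSpace.measurable_eq (α := ℝ≥0∞), borel_eq_generateFrom_Ioi]
    refine MeasurableSpace.generateFrom_le ?_
    rintro _ ⟨a, rfl⟩
    induction a with
    | top => simp
    | coe r =>
      refine MeasurableSpace.measurableSet_generateFrom ⟨r, ?_⟩
      ext x
      change (((r : ℝ≥0∞) : EReal) < (x : EReal)) ↔ _
      rw [EReal.coe_ennreal_lt_coe_ennreal_iff, Set.mem_Ioi]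
  · rintro _ ⟨v, rfl⟩
    exact measurableSet_exceeding v

section Nearest

variable {K : ℕ} {Ω : Type*} [MeasurableSpace Ω] {M : Network K} {o : Subject}
  {s : Fin (K + 1)} {u : Plane} {P : Measure Ω} {Φ : Fin (K + 1) → RandomPoints Ω}
  {state : Fin (K + 1) × ℕ → Ω → Channel}

theorem IsLinkState.measurable_nearestDist (h : IsLinkState M o s u Φ state P)
    (k : Fin (K + 1)) (c : Channel) : Measurable (nearestDist M s u Φ state k c) := by
  classical
  have : nearestDist M s u Φ state k c = fun ω => ⨅ n : ℕ,
      if IsNode Φ (k, n) ω ∧ state (k, n) ω = c then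
        ENNReal.ofReal (nodeDist M s u Φ (k, n) ω) else ∞ := by
    ext ω
    refine iInf_congr fun n => ?_
    split_ifs with hn <;> simp [hn]
  rw [this]
  exact Measurable.iInf fun n => Measurable.ite
    ((measurableSet_isNode Φ (k, n)).inter (h.measurable (k, n) c))
    (measurable_nodeDist M s u Φ (k, n)).ennreal_ofReal measurable_const

/-- Only finitely many nodes lie within any given distance. -/
def LocallyFinite (M : Network K) (s : Fin (K + 1)) (u : Plane)
    (Φ : Fin (K + 1) → RandomPoints Ω) (ω : Ω) : Prop :=
  ∀ (k : Fin (K + 1)) (m : ℕ), {n : ℕ | IsNode Φ (k, n) ω ∧ nodeDist M s u Φ (k, n) ω ≤ m}.Finite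

theorem ae_locallyFinite [IsProbabilityMeasure P]
    (hΦ : ∀ k, (Φ k).IsPoisson P (M.density o.candidates k)) :
    ∀ᵐ ω ∂P, LocallyFinite M s u Φ ω := by
  refine ae_all_iff.2 fun k => ae_all_iff.2 fun m => ?_
  filter_upwards [(hΦ k).ae_count_ne_top (Metric.isClosed_closedBall (x := u) (ε := m)).measurableSet
    measure_closedBall_lt_top.ne] with ω hω
  refine (Set.encard_ne_top_iff.1 hω).subset fun n hn => ⟨hn.1, ?_⟩
  rw [Metric.mem_closedBall, dist_eq_norm]
  exact (M.norm_sub_le_linkDist s k u _).trans hn.2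

theorem nearestDist_le {p : Fin (K + 1) × ℕ} {ω : Ω} (hp : IsNode Φ p ω) :
    nearestDist M s u Φ state p.1 (state p ω) ω ≤ ENNReal.ofReal (nodeDist M s u Φ p ω) :=
  iInf₂_le p.2 ⟨hp, rfl⟩

/-- One node of the type bounds the search to a ball, in which only finitely many nodes compete, so
the infimum is attained. -/
theorem LocallyFinite.exists_eq_nearestDist {ω : Ω} (h : LocallyFinite M s u Φ ω)
    {k : Fin (K + 1)} {c : Channel} (hV : nearestDist M s u Φ state k c ω ≠ ∞) :
    ∃ n, IsNode Φ (k, n) ω ∧ state (k, n) ω = c ∧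
      nearestDist M s u Φ state k c ω = ENNReal.ofReal (nodeDist M s u Φ (k, n) ω) := by
  have hex : ∃ n, IsNode Φ (k, n) ω ∧ state (k, n) ω = c := by
    by_contra! hno
    exact hV (iInf₂_eq_top.2 fun n hn => absurd hn.2 (hno n hn.1))
  obtain ⟨n₀, hn₀, hc₀⟩ := hex
  obtain ⟨m, hm⟩ := exists_nat_ge (nodeDist M s u Φ (k, n₀) ω)
  have hfin : {n : ℕ | (IsNode Φ (k, n) ω ∧ nodeDist M s u Φ (k, n) ω ≤ m) ∧
      state (k, n) ω = c}.Finite := (h k m).subset fun n hn => hn.1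
  obtain ⟨n, hn, hmin⟩ := Set.exists_min_image _ (fun n => nodeDist M s u Φ (k, n) ω) hfin
    ⟨n₀, ⟨hn₀, hm⟩, hc₀⟩
  refine ⟨n, hn.1.1, hn.2, le_antisymm (iInf₂_le n ⟨hn.1.1, hn.2⟩) (le_iInf₂ fun n' hn' => ?_)⟩
  refine ENNReal.ofReal_le_ofReal ?_
  by_cases h' : nodeDist M s u Φ (k, n') ω ≤ m
  · exact hmin n' ⟨⟨hn'.1, h'⟩, hn'.2⟩
  · exact hn.1.2.trans (not_le.1 h').le

/-- A strict bound on every node passes to the infimum only because the infimum is attained. -/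
theorem LocallyFinite.forall_exceeding_iff {ω : Ω} (h : LocallyFinite M s u Φ ω)
    (v : Fin (K + 1) × Channel → ℝ) :
    (∀ p, nearestDist M s u Φ state p.1 p.2 ω ∈ exceeding (v p)) ↔
      ∀ q, Beyond M s u Φ state v q ω := by
  constructor
  · intro hv q hq
    have := (hv (q.1, state q ω)).trans_le
      (EReal.coe_ennreal_le_coe_ennreal_iff.2 (nearestDist_le hq))
    exact (coe_lt_coe_ofReal_iff (nodeDist_nonneg q ω)).1 this
  · rintro hv ⟨k, c⟩
    by_cases hV : nearestDist M s u Φ state k c ω = ∞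
    · rw [hV]
      exact EReal.coe_lt_top _
    · obtain ⟨n, hn, rfl, hd⟩ := h.exists_eq_nearestDist hV
      rw [hd]
      exact (coe_lt_coe_ofReal_iff (nodeDist_nonneg _ ω)).2 (hv (k, n) hn)

variable [IsProbabilityMeasure P]

/-- Joint law of the distances to the nearest nodes of the different types. -/
theorem IsLinkState.measure_forall_exceeding (h : IsLinkState M o s u Φ state P)
    (hΦ : ∀ k, (Φ k).IsPoisson P (M.density o.candidates k))
    (hindep : iIndep (fun k => (Φ k).sigma) P) (v : Fin (K + 1) × Channel → ℝ) :
    P {ω | ∀ p, nearestDist M s u Φ state p.1 p.2 ω ∈ exceeding (v p)} =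
      ∏ p, ENNReal.ofReal (M.nearestCCDF o s p.1 p.2 (v p)) := by
  have hae : {ω | ∀ p, nearestDist M s u Φ state p.1 p.2 ω ∈ exceeding (v p)} =ᵐ[P]
      {ω | ∀ q, Beyond M s u Φ state v q ω} := by
    filter_upwards [ae_locallyFinite (s := s) (u := u) hΦ] with ω hω
    exact propext (hω.forall_exceeding_iff v)
  rw [measure_congr hae, ← ENNReal.ofReal_prod_of_nonneg
    fun p _ => M.nearestCCDF_nonneg o s p.1 p.2 (v p), ← ofReal_measureReal,
    h.measureReal_forall_beyond hΦ hindep v, Fintype.prod_prod_type]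
  congr 1
  exact Finset.prod_congr rfl fun k _ => M.exp_neg_integral_one_sub_beyondProb o s k u v

/-- The threshold `-1` imposes no condition and has CCDF one, so it removes the types outside `S`.
-/
theorem IsLinkState.measure_biInter_exceeding (h : IsLinkState M o s u Φ state P)
    (hΦ : ∀ k, (Φ k).IsPoisson P (M.density o.candidates k))
    (hindep : iIndep (fun k => (Φ k).sigma) P) (S : Finset (Fin (K + 1) × Channel))
    (v : Fin (K + 1) × Channel → ℝ) :
    P (⋂ p ∈ S, nearestDist M s u Φ state p.1 p.2 ⁻¹' exceeding (v p)) =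
      ∏ p ∈ S, ENNReal.ofReal (M.nearestCCDF o s p.1 p.2 (v p)) := by
  have := h.measure_forall_exceeding hΦ hindep fun p => if p ∈ S then v p else -1
  convert this using 1
  · congr 1
    ext ω
    simp only [Set.mem_iInter, Set.mem_preimage, Set.mem_ofPred_eq]
    refine forall_congr' fun p => ?_
    split_ifs with hp
    · simp [hp]
    · simp [hp, exceeding_of_neg]
  · rw [← Finset.prod_subset (Finset.subset_univ S)]
    · exact Finset.prod_congr rfl fun p hp => by rw [if_pos hp]
    · intro p _ hp
      rw [if_neg hp, M.nearestCCDF_of_neg _ _ _ _ neg_one_lt_zero, ENNReal.ofReal_one]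

theorem IsLinkState.measure_exceeding (h : IsLinkState M o s u Φ state P)
    (hΦ : ∀ k, (Φ k).IsPoisson P (M.density o.candidates k))
    (hindep : iIndep (fun k => (Φ k).sigma) P) (p : Fin (K + 1) × Channel) (v : ℝ) :
    P (nearestDist M s u Φ state p.1 p.2 ⁻¹' exceeding v) =
      ENNReal.ofReal (M.nearestCCDF o s p.1 p.2 v) := by
  simpa using h.measure_biInter_exceeding hΦ hindep {p} fun _ => v

/-- The sets `exceeding v` generate the σ-algebra and are stable under intersection, so the product
formula on them suffices. -/
theorem IsLinkState.iIndepFun_nearestDist (h : IsLinkState M o s u Φ state P)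
    (hΦ : ∀ k, (Φ k).IsPoisson P (M.density o.candidates k))
    (hindep : iIndep (fun k => (Φ k).sigma) P) :
    iIndepFun (fun (p : Fin (K + 1) × Channel) => nearestDist M s u Φ state p.1 p.2) P := by
  rw [iIndepFun_iff_iIndep]
  refine iIndepSets.iIndep (fun p => (h.measurable_nearestDist p.1 p.2).comap_le)
    (fun p => {A | ∃ v, nearestDist M s u Φ state p.1 p.2 ⁻¹' exceeding v = A}) (fun p => ?_)
    (fun p => ?_) ?_
  · rintro _ ⟨v, rfl⟩ _ ⟨w, rfl⟩ _
    exact ⟨max v w, by rw [← exceeding_inter, Set.preimage_inter]⟩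
  · rw [measurableSpace_eq_generateFrom_exceeding, MeasurableSpace.comap_generateFrom]
    congr 1
    ext A
    simp
  · rw [iIndepSets_iff]
    intro S f hf
    choose! v hv using hf
    have h1 : ⋂ p ∈ S, f p = ⋂ p ∈ S, nearestDist M s u Φ state p.1 p.2 ⁻¹' exceeding (v p) :=
      Set.iInter₂_congr fun p hp => (hv p hp).symm
    rw [h1, h.measure_biInter_exceeding hΦ hindep S v]
    exact Finset.prod_congr rfl fun p hp => by rw [← hv p hp, h.measure_exceeding hΦ hindep]

/-- Both measures are compared on the rays `Iic v`: a finite distance at most `v` is the complement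
of `exceeding v`. Restricting to finite values matters because `toReal` sends `∞` to zero. -/
theorem IsLinkState.map_toReal_nearestDist (h : IsLinkState M o s u Φ state P)
    (hΦ : ∀ k, (Φ k).IsPoisson P (M.density o.candidates k))
    (hindep : iIndep (fun k => (Φ k).sigma) P) (k : Fin (K + 1)) (c : Channel) :
    (P.restrict {ω | nearestDist M s u Φ state k c ω ≠ ∞}).map
        (fun ω => (nearestDist M s u Φ state k c ω).toReal) =
      volume.withDensity fun v => ENNReal.ofReal (M.nearestPDF o s k c v) := by
  have hV := h.measurable_nearestDist k c
  refine Measure.ext_of_Iic _ _ fun v => ?_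
  have hcompl : {ω | nearestDist M s u Φ state k c ω ≠ ∞ ∧
      (nearestDist M s u Φ state k c ω).toReal ≤ v} =
      (nearestDist M s u Φ state k c ⁻¹' exceeding v)ᶜ :=
    Set.ext fun ω => ne_top_and_toReal_le_iff
  rw [Measure.map_apply hV.ennreal_toReal measurableSet_Iic,
    Measure.restrict_apply (hV.ennreal_toReal measurableSet_Iic), Set.inter_comm,
    withDensity_apply _ measurableSet_Iic, M.setLIntegral_nearestPDF_Iic]
  refine (congrArg P hcompl).trans ?_
  rw [prob_compl_eq_one_sub (hV (measurableSet_exceeding v)),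
    h.measure_exceeding hΦ hindep (k, c) v, ENNReal.ofReal_sub _ (M.nearestCCDF_nonneg o s k c v),
    ENNReal.ofReal_one]

theorem IsLinkState.measure_nearestDist_mem (h : IsLinkState M o s u Φ state P)
    (hΦ : ∀ k, (Φ k).IsPoisson P (M.density o.candidates k))
    (hindep : iIndep (fun k => (Φ k).sigma) P) (k : Fin (K + 1)) (c : Channel) {B : Set ℝ}
    (hB : MeasurableSet B) :
    P {ω | nearestDist M s u Φ state k c ω ≠ ∞ ∧
        (nearestDist M s u Φ state k c ω).toReal ∈ B} =
      ∫⁻ v in B, ENNReal.ofReal (M.nearestPDF o s k c v) := by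
  have hV := h.measurable_nearestDist k c
  rw [← withDensity_apply _ hB, ← h.map_toReal_nearestDist hΦ hindep,
    Measure.map_apply hV.ennreal_toReal hB,
    Measure.restrict_apply (hV.ennreal_toReal hB), Set.inter_comm]
  rfl

theorem IsLinkState.measure_nearestDist_eq_ofReal (h : IsLinkState M o s u Φ state P)
    (hΦ : ∀ k, (Φ k).IsPoisson P (M.density o.candidates k))
    (hindep : iIndep (fun k => (Φ k).sigma) P) (k : Fin (K + 1)) (c : Channel) (r : ℝ) :
    P (nearestDist M s u Φ state k c ⁻¹' {ENNReal.ofReal r}) = 0 := by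
  have h0 := h.measure_nearestDist_mem hΦ hindep k c
    (measurableSet_singleton (ENNReal.ofReal r).toReal)
  rw [Measure.restrict_eq_zero.2 (measure_singleton _), lintegral_zero_measure] at h0
  refine measure_mono_null (fun ω hω => ?_) h0
  have hω' : nearestDist M s u Φ state k c ω = ENNReal.ofReal r := hω
  simp [hω']

end Nearest

/-! ### Metric comparisons and exclusion distances -/

theorem ofReal_mul_inv_le_iff {B B' x x' : ℝ} (hB : 0 < B) (hB' : 0 < B') (hx : 0 ≤ x)
    (hx' : 0 ≤ x') :
    ENNReal.ofReal B' * (ENNReal.ofReal x')⁻¹ ≤ ENNReal.ofReal B * (ENNReal.ofReal x)⁻¹ ↔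
      x * B' / B ≤ x' := by
  rcases hx.eq_or_lt with rfl | hx
  · simp [ENNReal.mul_top, hB, hx']
  rcases hx'.eq_or_lt with rfl | hx'
  · have h1 : 0 < x * B' / B := by positivity
    have h2 : ENNReal.ofReal B * (ENNReal.ofReal x)⁻¹ < ∞ :=
      ENNReal.mul_lt_top ENNReal.ofReal_lt_top (by simp [hx])
    simp [ENNReal.mul_top, hB', h2.ne, h1.not_ge]
  · rw [← ENNReal.ofReal_inv_of_pos hx, ← ENNReal.ofReal_inv_of_pos hx',
      ← ENNReal.ofReal_mul hB'.le, ← ENNReal.ofReal_mul hB.le,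
      ENNReal.ofReal_le_ofReal_iff (by positivity), ← div_eq_mul_inv, ← div_eq_mul_inv,
      div_le_div_iff₀ hx' hx, div_le_iff₀ hB, mul_comm B', mul_comm B]

namespace Network

variable {K : ℕ} (M : Network K) (o : Subject) (a : Criterion) (s t k : Fin (K + 1))
  (c c' : Channel)

/-- The metric decreases with distance, and the exclusion distance is where the two metrics agree.
At distance zero the metric is `∞`, so the comparison persists there. -/
theorem metric_le_metric_iff {d d' : ℝ} (hd : 0 ≤ d) (hd' : 0 ≤ d') :
    M.metric a k c' d' ≤ M.metric a t c d ↔ M.exclusion a t c k c' d ≤ d' := by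
  have hk := M.bias_pos k
  have ht := M.bias_pos t
  cases a with
  | nearest => exact ofReal_mul_inv_le_iff ht hk hd hd'
  | strongest =>
    have hα := M.pathloss_pos c
    have hα' := M.pathloss_pos c'
    simp only [metric, exclusion]
    rw [ENNReal.rpow_neg, ENNReal.rpow_neg, ENNReal.ofReal_rpow_of_nonneg hd hα.le,
      ENNReal.ofReal_rpow_of_nonneg hd' hα'.le,
      ofReal_mul_inv_le_iff ht hk (Real.rpow_nonneg hd _) (Real.rpow_nonneg hd' _), one_div,
      Real.rpow_inv_le_iff_of_pos (by positivity) hd' hα']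

/-- The reverse comparison is what excludes a selected node lying strictly beyond its exclusion
distance. -/
theorem metric_le_metric_iff' {d d' : ℝ} (hd : 0 ≤ d) (hd' : 0 ≤ d') :
    M.metric a t c d ≤ M.metric a k c' d' ↔ d' ≤ M.exclusion a t c k c' d := by
  have hk := M.bias_pos k
  have ht := M.bias_pos t
  have hflip : ∀ x x' : ℝ, x' * M.bias t / M.bias k ≤ x ↔ x' ≤ x * M.bias k / M.bias t :=
    fun x x' => by rw [div_le_iff₀ hk, le_div_iff₀ ht]
  cases a with
  | nearest => exact (ofReal_mul_inv_le_iff hk ht hd' hd).trans (hflip d d')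
  | strongest =>
    have hα := M.pathloss_pos c
    have hα' := M.pathloss_pos c'
    simp only [metric, exclusion]
    rw [ENNReal.rpow_neg, ENNReal.rpow_neg, ENNReal.ofReal_rpow_of_nonneg hd hα.le,
      ENNReal.ofReal_rpow_of_nonneg hd' hα'.le,
      ofReal_mul_inv_le_iff hk ht (Real.rpow_nonneg hd' _) (Real.rpow_nonneg hd _), hflip, one_div,
      Real.le_rpow_inv_iff_of_pos hd' (by positivity) hα']

theorem exclusion_nonneg {d : ℝ} (hd : 0 ≤ d) : 0 ≤ M.exclusion a t c k c' d := by
  have hk := M.bias_pos k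
  have ht := M.bias_pos t
  cases a <;> simp only [exclusion] <;> positivity

theorem exclusion_self {d : ℝ} (hd : 0 ≤ d) : M.exclusion a t c t c d = d := by
  have ht := M.bias_pos t
  cases a <;> simp only [exclusion]
  · rw [mul_div_cancel_right₀ _ ht.ne']
  · rw [mul_div_cancel_right₀ _ ht.ne', one_div, Real.rpow_rpow_inv hd (M.pathloss_pos c).ne']

theorem measurable_exclusion : Measurable (M.exclusion a t c k c') := by
  cases a
  · exact (measurable_id.mul_const _).div_const _
  · exact (((measurable_id.pow_const _).mul_const _).div_const _).pow_const _

theorem measurable_mainLinkWeight : Measurable (M.mainLinkWeight o a s t c) :=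
  (M.measurable_nearestPDF o s t c).mul (Finset.measurable_fun_prod _ fun p _ =>
    (M.continuous_nearestCCDF o s p.1 p.2).measurable.comp
      (M.measurable_exclusion a t p.1 c p.2))

theorem mainLinkWeight_nonneg (y : ℝ) : 0 ≤ M.mainLinkWeight o a s t c y :=
  mul_nonneg (M.nearestPDF_nonneg o s t c y)
    (Finset.prod_nonneg fun p _ => M.nearestCCDF_nonneg o s p.1 p.2 _)

theorem mainLinkWeight_of_neg {y : ℝ} (hy : y < 0) : M.mainLinkWeight o a s t c y = 0 := by
  rw [mainLinkWeight, M.nearestPDF_of_lt o s t c (hy.trans_le (M.gap_nonneg s t)), zero_mul]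

theorem mainLinkPDF_eq (y : ℝ) :
    M.mainLinkPDF o a s t c y = (M.assocProb o a s t c)⁻¹ * M.mainLinkWeight o a s t c y := by
  rw [mainLinkPDF, mainLinkWeight]
  ring

theorem lintegral_mainLinkWeight : ∫⁻ y, ENNReal.ofReal (M.mainLinkWeight o a s t c y) =
    ∫⁻ y in Set.Ioi 0, ENNReal.ofReal (M.mainLinkWeight o a s t c y) := by
  rw [restrict_Ioi_eq_restrict_Ici, ← lintegral_indicator measurableSet_Ici]
  refine lintegral_congr fun y => ?_
  by_cases hy : y ∈ Set.Ici (0 : ℝ)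
  · rw [Set.indicator_of_mem hy]
  · rw [Set.indicator_of_notMem hy, M.mainLinkWeight_of_neg o a s t c (by simpa using hy),
      ENNReal.ofReal_zero]

end Network

theorem mem_exceeding_iff {v : ℝ} (hv : 0 ≤ v) {x : ℝ≥0∞} :
    x ∈ exceeding v ↔ ENNReal.ofReal v < x := by
  rw [← EReal.coe_ennreal_lt_coe_ennreal_iff, EReal.coe_ennreal_ofReal, max_eq_left hv]
  rfl

/-- Probability of a joint event of two independent random variables. -/
theorem IndepFun.measure_prodMk_mem {Ω α β : Type*} [MeasurableSpace Ω] [MeasurableSpace α]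
    [MeasurableSpace β] {P : Measure Ω} [IsProbabilityMeasure P] {X : Ω → α} {Z : Ω → β}
    (h : X ⟂ᵢ[P] Z) (hX : Measurable X) (hZ : Measurable Z) {S : Set (α × β)}
    (hS : MeasurableSet S) :
    P {ω | (X ω, Z ω) ∈ S} = ∫⁻ ω, P {ω' | (X ω, Z ω') ∈ S} ∂P := by
  have := Measure.isProbabilityMeasure_map (μ := P) hZ.aemeasurable
  have h1 : P {ω | (X ω, Z ω) ∈ S} = (P.map fun ω => (X ω, Z ω)) S :=
    (Measure.map_apply (hX.prodMk hZ) hS).symm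
  rw [h1, (indepFun_iff_map_prod_eq_prod_map_map hX.aemeasurable hZ.aemeasurable).1 h,
    Measure.prod_apply hS, lintegral_map (measurable_measure_prodMk_left hS) hX]
  refine lintegral_congr fun ω => ?_
  rw [Measure.map_apply hZ (measurable_prodMk_left hS)]
  rfl

/-! ### The association event in terms of nearest distances -/

section Association

variable {K : ℕ} {Ω : Type*} [MeasurableSpace Ω] {M : Network K} {o : Subject} {a : Criterion}
  {s : Fin (K + 1)} {u : Plane} {P : Measure Ω} {Φ : Fin (K + 1) → RandomPoints Ω}
  {state : Fin (K + 1) × ℕ → Ω → Channel} {sel : Ω → Option (Fin (K + 1) × ℕ)}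

/-- There is a node of type `(t, c)`, and the nearest one beats the nodes of all other types. -/
def nearestWins (M : Network K) (a : Criterion) (s : Fin (K + 1)) (u : Plane)
    (Φ : Fin (K + 1) → RandomPoints Ω) (state : Fin (K + 1) × ℕ → Ω → Channel)
    (t : Fin (K + 1)) (c : Channel) : Set Ω :=
  {ω | nearestDist M s u Φ state t c ω ≠ ∞ ∧
    ∀ p ∈ (Finset.univ : Finset (Fin (K + 1) × Channel)).erase (t, c),
      nearestDist M s u Φ state p.1 p.2 ω ∈
        exceeding (M.exclusion a t c p.1 p.2 (nearestDist M s u Φ state t c ω).toReal)}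

/-- The nearest nodes of type `(t, c)` and of type `p` are equally good. -/
def Tie (M : Network K) (a : Criterion) (s : Fin (K + 1)) (u : Plane)
    (Φ : Fin (K + 1) → RandomPoints Ω) (state : Fin (K + 1) × ℕ → Ω → Channel)
    (t : Fin (K + 1)) (c : Channel) (p : Fin (K + 1) × Channel) (ω : Ω) : Prop :=
  nearestDist M s u Φ state t c ω ≠ ∞ ∧ nearestDist M s u Φ state p.1 p.2 ω =
    ENNReal.ofReal (M.exclusion a t c p.1 p.2 (nearestDist M s u Φ state t c ω).toReal)

/-- Within one type the exclusion distance is the distance itself, so a best node is a nearest one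
of its type. -/
theorem IsBest.nearestDist_eq {q : Fin (K + 1) × ℕ} {ω : Ω} (h : IsBest M a s u Φ state q ω) :
    nearestDist M s u Φ state q.1 (state q ω) ω = ENNReal.ofReal (nodeDist M s u Φ q ω) := by
  refine le_antisymm (nearestDist_le h.1) (le_iInf₂ fun n hn => ENNReal.ofReal_le_ofReal ?_)
  have := (M.metric_le_metric_iff a q.1 q.1 (state q ω) (state (q.1, n) ω)
    (nodeDist_nonneg q ω) (nodeDist_nonneg (q.1, n) ω)).1 (h.2 (q.1, n) hn.1)
  rwa [hn.2, M.exclusion_self a q.1 _ (nodeDist_nonneg q ω)] at this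

theorem IsBest.exclusion_le_nearestDist {q : Fin (K + 1) × ℕ} {ω : Ω}
    (h : IsBest M a s u Φ state q ω) (k : Fin (K + 1)) (c' : Channel) :
    ENNReal.ofReal (M.exclusion a q.1 (state q ω) k c' (nodeDist M s u Φ q ω)) ≤
      nearestDist M s u Φ state k c' ω := by
  refine le_iInf₂ fun n hn => ENNReal.ofReal_le_ofReal ?_
  have := (M.metric_le_metric_iff a q.1 k (state q ω) (state (k, n) ω)
    (nodeDist_nonneg q ω) (nodeDist_nonneg (k, n) ω)).1 (h.2 (k, n) hn.1)
  rwa [hn.2] at this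

/-- A best node is nearest in its type and no other type beats it; the absence of ties makes the
inequalities strict. Conversely, an attained nearest node that wins strictly is a maximizer, so some
node is selected, and a node of another type would be strictly worse. -/
theorem mem_assocEvent_iff {ω : Ω} {t : Fin (K + 1)} {c : Channel}
    (hfin : LocallyFinite M s u Φ ω)
    (hsel : (∀ p, sel ω = some p → IsBest M a s u Φ state p ω) ∧
      (sel ω = none → ∀ p, ¬ IsBest M a s u Φ state p ω))
    (htie : ∀ p ∈ (Finset.univ : Finset (Fin (K + 1) × Channel)).erase (t, c),
      ¬ Tie M a s u Φ state t c p ω) :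
    ω ∈ assocEvent state sel t c ↔ ω ∈ nearestWins M a s u Φ state t c := by
  constructor
  · rintro ⟨n, hn, rfl⟩
    have hbest := hsel.1 _ hn
    have hV := hbest.nearestDist_eq
    have hV' : nearestDist M s u Φ state t (state (t, n) ω) ω ≠ ∞ := by
      rw [hV]; exact ENNReal.ofReal_ne_top
    refine ⟨hV', fun p hp => ?_⟩
    rw [mem_exceeding_iff (M.exclusion_nonneg _ _ _ _ _ ENNReal.toReal_nonneg)]
    refine lt_of_le_of_ne ?_ fun heq => htie p hp ⟨hV', heq.symm⟩
    have := hbest.exclusion_le_nearestDist p.1 p.2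
    rwa [hV, ENNReal.toReal_ofReal (nodeDist_nonneg _ ω)]
  · rintro ⟨hV, hex⟩
    obtain ⟨n, hn, hc, hd⟩ := hfin.exists_eq_nearestDist hV
    rw [hd, ENNReal.toReal_ofReal (nodeDist_nonneg _ ω)] at hex
    have hlt : ∀ q, IsNode Φ q ω → (q.1, state q ω) ≠ (t, c) →
        M.exclusion a t c q.1 (state q ω) (nodeDist M s u Φ (t, n) ω) < nodeDist M s u Φ q ω := by
      intro q hq hne
      have h1 := hex (q.1, state q ω) (Finset.mem_erase.2 ⟨hne, Finset.mem_univ _⟩)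
      exact (coe_lt_coe_ofReal_iff (nodeDist_nonneg q ω)).1
        (h1.trans_le (EReal.coe_ennreal_le_coe_ennreal_iff.2 (nearestDist_le hq)))
    have hbest : IsBest M a s u Φ state (t, n) ω := by
      refine ⟨hn, fun q hq => ?_⟩
      rw [M.metric_le_metric_iff a t q.1 _ _ (nodeDist_nonneg _ ω) (nodeDist_nonneg q ω), hc]
      by_cases hne : (q.1, state q ω) = (t, c)
      · obtain ⟨h1, h2⟩ := Prod.ext_iff.1 hne
        simp only at h1 h2
        rw [h2, h1, M.exclusion_self a t c (nodeDist_nonneg _ ω)]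
        have := nearestDist_le (M := M) (s := s) (u := u) (state := state) hq
        rw [h2, h1, hd] at this
        exact (ENNReal.ofReal_le_ofReal_iff (nodeDist_nonneg q ω)).1 this
      · exact (hlt q hq hne).le
    cases hs : sel ω with
    | none => exact absurd hbest (hsel.2 hs _)
    | some q =>
      have hq := hsel.1 q hs
      -- Several nodes of type `(t, c)` may be equally near, so the selected index may differ from
      -- `n`; only the type is forced.
      by_cases hne : (q.1, state q ω) = (t, c)
      · obtain ⟨h1, h2⟩ := Prod.ext_iff.1 hne
        simp only at h1 h2
        obtain ⟨k, m⟩ := q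
        simp only at h1
        subst h1
        exact ⟨m, hs, h2⟩
      · have hle := hq.2 _ hn
        rw [hc, M.metric_le_metric_iff' a t q.1 c _ (nodeDist_nonneg _ ω)
          (nodeDist_nonneg q ω)] at hle
        exact absurd hle (not_le.2 (hlt q hq.1 hne))

theorem mainLinkDist_eq_of_mem {ω : Ω} {t : Fin (K + 1)} {c : Channel}
    (hsel : ∀ p, sel ω = some p → IsBest M a s u Φ state p ω)
    (h : ω ∈ assocEvent state sel t c) :
    mainLinkDist M s u Φ sel ω = (nearestDist M s u Φ state t c ω).toReal := by
  obtain ⟨n, hn, rfl⟩ := h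
  have := (hsel _ hn).nearestDist_eq
  simp only at this
  rw [this, ENNReal.toReal_ofReal (nodeDist_nonneg _ ω), mainLinkDist, hn]

theorem IsLinkState.measurableSet_nearestWins (h : IsLinkState M o s u Φ state P)
    (a : Criterion) (t : Fin (K + 1)) (c : Channel) :
    MeasurableSet (nearestWins M a s u Φ state t c) := by
  have hV := h.measurable_nearestDist
  have : nearestWins M a s u Φ state t c = {ω | nearestDist M s u Φ state t c ω ≠ ∞} ∩
      ⋂ p ∈ (Finset.univ : Finset (Fin (K + 1) × Channel)).erase (t, c),
        {ω | ((M.exclusion a t c p.1 p.2 (nearestDist M s u Φ state t c ω).toReal : ℝ) : EReal) <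
          nearestDist M s u Φ state p.1 p.2 ω} := by
    ext ω
    simp only [nearestWins, exceeding, Set.mem_inter_iff, Set.mem_iInter, Set.mem_ofPred_eq]
  rw [this]
  exact (hV t c (measurableSet_singleton ∞).compl).inter
    (Finset.measurableSet_biInter _ fun p _ => measurableSet_lt
      (((M.measurable_exclusion a t p.1 c p.2).comp (hV t c).ennreal_toReal).coe_real_ereal)
      (hV p.1 p.2).coe_ereal_ennreal)

variable [IsProbabilityMeasure P]

/-- Given the distance of type `(t, c)`, a tie requires an independent distance to take one
prescribed finite value, an event of probability zero. -/
theorem IsLinkState.ae_not_tie (h : IsLinkState M o s u Φ state P)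
    (hΦ : ∀ k, (Φ k).IsPoisson P (M.density o.candidates k))
    (hindep : iIndep (fun k => (Φ k).sigma) P) (a : Criterion) (t : Fin (K + 1)) (c : Channel)
    {p : Fin (K + 1) × Channel} (hp : p ≠ (t, c)) :
    ∀ᵐ ω ∂P, ¬ Tie M a s u Φ state t c p ω := by
  have hi := (h.iIndepFun_nearestDist hΦ hindep).indepFun hp.symm
  have hS : MeasurableSet {x : ℝ≥0∞ × ℝ≥0∞ | x.1 ≠ ∞ ∧
      x.2 = ENNReal.ofReal (M.exclusion a t c p.1 p.2 x.1.toReal)} :=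
    MeasurableSet.inter (measurable_fst (measurableSet_singleton ∞).compl)
      (measurableSet_eq_fun measurable_snd ((M.measurable_exclusion a t p.1 c p.2).comp
        measurable_fst.ennreal_toReal).ennreal_ofReal)
  have h1 := IndepFun.measure_prodMk_mem hi (h.measurable_nearestDist _ _)
    (h.measurable_nearestDist _ _) hS
  have h0 : ∀ x : ℝ≥0∞, P {ω' | (x, nearestDist M s u Φ state p.1 p.2 ω') ∈
      {x : ℝ≥0∞ × ℝ≥0∞ | x.1 ≠ ∞ ∧
        x.2 = ENNReal.ofReal (M.exclusion a t c p.1 p.2 x.1.toReal)}} = 0 := fun x =>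
    measure_mono_null (t := nearestDist M s u Φ state p.1 p.2 ⁻¹'
      {ENNReal.ofReal (M.exclusion a t c p.1 p.2 x.toReal)}) (fun ω' hω' => hω'.2)
      (h.measure_nearestDist_eq_ofReal hΦ hindep p.1 p.2 _)
  simp_rw [h0, lintegral_zero] at h1
  rw [ae_iff]
  simp only [not_not]
  exact h1

/-- The distance of type `(t, c)` is independent of the family of all others. Freezing it at a
finite value turns the event into a joint exceedance whose probability is the product `g` of CCDFs,
which is then integrated against the density. -/
theorem IsLinkState.measure_nearestWins_inter (h : IsLinkState M o s u Φ state P)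
    (hΦ : ∀ k, (Φ k).IsPoisson P (M.density o.candidates k))
    (hindep : iIndep (fun k => (Φ k).sigma) P) (a : Criterion) (t : Fin (K + 1)) (c : Channel)
    {B : Set ℝ} (hB : MeasurableSet B) :
    P (nearestWins M a s u Φ state t c ∩
        (fun ω => (nearestDist M s u Φ state t c ω).toReal) ⁻¹' B) =
      ∫⁻ y in B, ENNReal.ofReal (M.mainLinkWeight o a s t c y) := by
  have hV := h.measurable_nearestDist
  let I := (Finset.univ : Finset (Fin (K + 1) × Channel)).erase (t, c)
  let Z : Ω → I → ℝ≥0∞ := fun ω p => nearestDist M s u Φ state p.1.1 p.1.2 ω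
  let g : ℝ → ℝ≥0∞ := fun y =>
    ∏ p ∈ I, ENNReal.ofReal (M.nearestCCDF o s p.1 p.2 (M.exclusion a t c p.1 p.2 y))
  have hZ : Measurable Z := measurable_pi_lambda _ fun p => hV p.1.1 p.1.2
  have hg : Measurable g := Finset.measurable_fun_prod _ fun p _ =>
    ((M.continuous_nearestCCDF o s p.1 p.2).measurable.comp
      (M.measurable_exclusion a t p.1 c p.2)).ennreal_ofReal
  have hi : nearestDist M s u Φ state t c ⟂ᵢ[P] Z :=
    ((h.iIndepFun_nearestDist hΦ hindep).indepFun_finset {(t, c)} I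
      (Finset.disjoint_singleton_left.2 (Finset.notMem_erase _ _)) fun p => hV p.1 p.2).comp
      (measurable_pi_apply (⟨(t, c), Finset.mem_singleton_self _⟩ :
        ({(t, c)} : Finset (Fin (K + 1) × Channel)))) measurable_id
  let S : Set (ℝ≥0∞ × (I → ℝ≥0∞)) := {x | (x.1 ≠ ∞ ∧ x.1.toReal ∈ B) ∧
    ∀ p : I, ((M.exclusion a t c p.1.1 p.1.2 x.1.toReal : ℝ) : EReal) < (x.2 p : EReal)}
  have hS : MeasurableSet S := by
    have : S = ({x | x.1 ≠ ∞} ∩ {x | x.1.toReal ∈ B}) ∩ ⋂ p : I,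
        {x | ((M.exclusion a t c p.1.1 p.1.2 x.1.toReal : ℝ) : EReal) < (x.2 p : EReal)} := by
      ext x
      simp only [S, Set.mem_inter_iff, Set.mem_iInter, Set.mem_ofPred_eq]
    rw [this]
    exact ((measurable_fst (measurableSet_singleton ∞).compl).inter
      (measurable_fst.ennreal_toReal hB)).inter (MeasurableSet.iInter fun p => measurableSet_lt
      (((M.measurable_exclusion a t p.1.1 c p.1.2).comp
        measurable_fst.ennreal_toReal).coe_real_ereal)
      ((measurable_pi_apply p).comp measurable_snd).coe_ereal_ennreal)
  have hset : nearestWins M a s u Φ state t c ∩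
      (fun ω => (nearestDist M s u Φ state t c ω).toReal) ⁻¹' B =
      {ω | (nearestDist M s u Φ state t c ω, Z ω) ∈ S} := by
    ext ω
    simp only [nearestWins, exceeding, S, Z, I, Set.mem_inter_iff, Set.mem_preimage,
      Set.mem_ofPred_eq, Subtype.forall]
    tauto
  -- The slice at `∞` is empty, so the infinite value, which has no density, contributes nothing.
  have hslice : ∀ x : ℝ≥0∞, P {ω' | (x, Z ω') ∈ S} =
      {x : ℝ≥0∞ | x ≠ ∞}.indicator (fun x => B.indicator g x.toReal) x := by
    intro x
    by_cases hx : x ≠ ∞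
    · rw [Set.indicator_of_mem (show x ∈ {x : ℝ≥0∞ | x ≠ ∞} from hx)]
      by_cases hxB : x.toReal ∈ B
      · rw [Set.indicator_of_mem hxB]
        simp only [g]
        rw [← h.measure_biInter_exceeding hΦ hindep I
          fun p => M.exclusion a t c p.1 p.2 x.toReal]
        congr 1
        ext ω
        simp [S, Z, hx, hxB, exceeding]
      · rw [Set.indicator_of_notMem hxB]
        simp [S, hxB]
    · rw [Set.indicator_of_notMem (show x ∉ {x : ℝ≥0∞ | x ≠ ∞} from hx)]
      simp only [S, hx, Set.mem_ofPred_eq, false_and, Set.ofPred_false, measure_empty]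
  rw [hset, IndepFun.measure_prodMk_mem hi (hV t c) hZ hS]
  simp_rw [hslice]
  have hind : ∀ ω, {x : ℝ≥0∞ | x ≠ ∞}.indicator (fun x => B.indicator g x.toReal)
      (nearestDist M s u Φ state t c ω) =
      {ω | nearestDist M s u Φ state t c ω ≠ ∞}.indicator
        (fun ω => B.indicator g (nearestDist M s u Φ state t c ω).toReal) ω := fun ω => rfl
  simp_rw [hind]
  have hfin : MeasurableSet {ω | nearestDist M s u Φ state t c ω ≠ ∞} :=
    hV t c (measurableSet_singleton ∞).compl
  rw [lintegral_indicator hfin,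
    ← lintegral_map (hg.indicator hB) (hV t c).ennreal_toReal,
    h.map_toReal_nearestDist hΦ hindep, lintegral_indicator hB,
    restrict_withDensity hB,
    lintegral_withDensity_eq_lintegral_mul _
      (M.measurable_nearestPDF o s t c).ennreal_ofReal hg]
  refine lintegral_congr fun y => ?_
  rw [Pi.mul_apply, Network.mainLinkWeight, ENNReal.ofReal_mul (M.nearestPDF_nonneg o s t c y),
    ENNReal.ofReal_prod_of_nonneg fun p _ => M.nearestCCDF_nonneg o s p.1 p.2 _]

end Association

/-! ### Association probability and conditional law of the main link -/

section MainLink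

variable {K : ℕ} {Ω : Type*} [MeasurableSpace Ω] {M : Network K} {o : Subject} {a : Criterion}
  {s : Fin (K + 1)} {u : Plane} {P : Measure Ω} [IsProbabilityMeasure P]
  {Φ : Fin (K + 1) → RandomPoints Ω}
  {state : Fin (K + 1) × ℕ → Ω → Channel} {sel : Ω → Option (Fin (K + 1) × ℕ)}

theorem IsLinkState.assocEvent_ae_eq (h : IsLinkState M o s u Φ state P)
    (hΦ : ∀ k, (Φ k).IsPoisson P (M.density o.candidates k))
    (hindep : iIndep (fun k => (Φ k).sigma) P) (hsel : IsAssociation M a s u Φ state sel P)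
    (t : Fin (K + 1)) (c : Channel) :
    assocEvent state sel t c =ᵐ[P] nearestWins M a s u Φ state t c := by
  have htie : ∀ᵐ ω ∂P, ∀ p : Fin (K + 1) × Channel, p ≠ (t, c) →
      ¬ Tie M a s u Φ state t c p ω := by
    refine ae_all_iff.2 fun p => ?_
    by_cases hp : p = (t, c)
    · exact ae_of_all _ fun ω hne => absurd hp hne
    · filter_upwards [h.ae_not_tie hΦ hindep a t c hp] with ω hω _
      exact hω
  filter_upwards [ae_locallyFinite (s := s) (u := u) hΦ, hsel, htie] with ω h1 h2 h3
  exact propext (mem_assocEvent_iff h1 h2 fun p hp => h3 p (Finset.ne_of_mem_erase hp))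

theorem IsLinkState.lintegral_mainLinkWeight_eq (h : IsLinkState M o s u Φ state P)
    (hΦ : ∀ k, (Φ k).IsPoisson P (M.density o.candidates k))
    (hindep : iIndep (fun k => (Φ k).sigma) P) (a : Criterion) (t : Fin (K + 1)) (c : Channel) :
    ∫⁻ y in Set.Ioi 0, ENNReal.ofReal (M.mainLinkWeight o a s t c y) =
      P (nearestWins M a s u Φ state t c) := by
  have := h.measure_nearestWins_inter hΦ hindep a t c MeasurableSet.univ
  rw [Set.preimage_univ, Set.inter_univ, Measure.restrict_univ, M.lintegral_mainLinkWeight] at this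
  exact this.symm

/-- The weight is nonnegative and its total integral is the probability of an event, hence finite.
-/
theorem IsLinkState.integrableOn_mainLinkWeight (h : IsLinkState M o s u Φ state P)
    (hΦ : ∀ k, (Φ k).IsPoisson P (M.density o.candidates k))
    (hindep : iIndep (fun k => (Φ k).sigma) P) (a : Criterion) (t : Fin (K + 1)) (c : Channel) :
    IntegrableOn (M.mainLinkWeight o a s t c) (Set.Ioi 0) := by
  refine ⟨(M.measurable_mainLinkWeight o a s t c).aestronglyMeasurable, ?_⟩
  rw [hasFiniteIntegral_iff_ofReal (ae_of_all _ (M.mainLinkWeight_nonneg o a s t c)),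
    h.lintegral_mainLinkWeight_eq hΦ hindep]
  exact measure_lt_top P _

theorem IsLinkState.measure_nearestWins (h : IsLinkState M o s u Φ state P)
    (hΦ : ∀ k, (Φ k).IsPoisson P (M.density o.candidates k))
    (hindep : iIndep (fun k => (Φ k).sigma) P) (a : Criterion) (t : Fin (K + 1)) (c : Channel) :
    P (nearestWins M a s u Φ state t c) = ENNReal.ofReal (M.assocProb o a s t c) := by
  rw [Network.assocProb, ofReal_integral_eq_lintegral_ofReal
    (h.integrableOn_mainLinkWeight hΦ hindep a t c)
    (ae_of_all _ (M.mainLinkWeight_nonneg o a s t c)), h.lintegral_mainLinkWeight_eq hΦ hindep]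

/-- The selection is not assumed measurable, so the event is replaced by the almost surely equal
`nearestWins` and the link length by the nearest distance, both measurable. Conditioning then
divides the weight by the association probability. -/
theorem IsLinkState.map_mainLinkDist (h : IsLinkState M o s u Φ state P)
    (hΦ : ∀ k, (Φ k).IsPoisson P (M.density o.candidates k))
    (hindep : iIndep (fun k => (Φ k).sigma) P) (hsel : IsAssociation M a s u Φ state sel P)
    (t : Fin (K + 1)) (c : Channel) (hpos : P (assocEvent state sel t c) ≠ 0) :
    AEMeasurable (mainLinkDist M s u Φ sel) (ProbabilityTheory.cond P (assocEvent state sel t c)) ∧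
      (ProbabilityTheory.cond P (assocEvent state sel t c)).map (mainLinkDist M s u Φ sel) =
        volume.withDensity fun y => ENNReal.ofReal (M.mainLinkPDF o a s t c y) := by
  have hae := h.assocEvent_ae_eq hΦ hindep hsel t c
  have hW := h.measurableSet_nearestWins a t c
  have hV := (h.measurable_nearestDist t c).ennreal_toReal
  have hcond : ProbabilityTheory.cond P (assocEvent state sel t c) = ProbabilityTheory.cond P (nearestWins M a s u Φ state t c) := by
    rw [ProbabilityTheory.cond, ProbabilityTheory.cond, measure_congr hae, Measure.restrict_congr_set hae]
  have hdist : mainLinkDist M s u Φ sel =ᵐ[ProbabilityTheory.cond P (nearestWins M a s u Φ state t c)]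
      fun ω => (nearestDist M s u Φ state t c ω).toReal := by
    refine (Measure.smul_absolutelyContinuous.ae_le : _ ≤ ae (P.restrict _)) ?_
    refine (ae_restrict_iff' hW).2 ?_
    filter_upwards [hae, hsel] with ω h1 h2 hω
    exact mainLinkDist_eq_of_mem h2.1 (h1.mpr hω)
  rw [measure_congr hae, h.measure_nearestWins hΦ hindep, ne_eq, ENNReal.ofReal_eq_zero,
    not_le] at hpos
  rw [hcond]
  refine ⟨hV.aemeasurable.congr hdist.symm, ?_⟩
  rw [Measure.map_congr hdist]
  ext B hB
  rw [Measure.map_apply hV hB, cond_apply hW, h.measure_nearestWins_inter hΦ hindep a t c hB,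
    withDensity_apply _ hB, h.measure_nearestWins hΦ hindep, ← ENNReal.ofReal_inv_of_pos hpos,
    ← lintegral_const_mul _ (M.measurable_mainLinkWeight o a s t c).ennreal_ofReal]
  refine lintegral_congr fun y => ?_
  rw [M.mainLinkPDF_eq, ENNReal.ofReal_mul (inv_nonneg.2 hpos.le)]

end MainLink

theorem Network.measurable_mainLinkPDF {K : ℕ} (M : Network K) (o : Subject) (a : Criterion)
    (s t : Fin (K + 1)) (c : Channel) : Measurable (M.mainLinkPDF o a s t c) := by
  simp_rw [funext (M.mainLinkPDF_eq o a s t c)]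
  exact (M.measurable_mainLinkWeight o a s t c).const_mul _

end AerialNet

end

theorem lemma1 {K : ℕ} (M : AerialNet.Network K)
    (o : AerialNet.Subject) (a : AerialNet.Criterion)
    -- receiver layer `i`, transmitter layer `j`, channel `c` of the main link
    (i j : Fin (K + 1)) (c : AerialNet.Channel)
    -- layers of the selecting and of the selected end of the main link
    (s t : Fin (K + 1)) (hs : s = o.selecting i j) (ht : t = o.selected i j)
    -- horizontal position of the selecting node
    (u : AerialNet.Plane)
    {Ω : Type*} [MeasurableSpace Ω] (P : Measure Ω) [IsProbabilityMeasure P]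
    -- the nodes among which the selecting node chooses: independent Poisson processes
    (Φ : Fin (K + 1) → AerialNet.RandomPoints Ω)
    (hΦ : ∀ k, (Φ k).IsPoisson P (M.density o.candidates k))
    (hindep : iIndep (fun k => (Φ k).sigma) P)
    -- the states of the links from the selecting node
    (state : Fin (K + 1) × ℕ → Ω → AerialNet.Channel)
    (hstate : AerialNet.IsLinkState M o s u Φ state P)
    -- the associated node
    (sel : Ω → Option (Fin (K + 1) × ℕ))
    (hsel : AerialNet.IsAssociation M a s u Φ state sel P) :
    -- CCDF and PDF of the nearest-node distances
    (∀ (k : Fin (K + 1)) (c' : AerialNet.Channel),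
      (∀ v : ℝ, P {ω | (v : EReal) < (AerialNet.nearestDist M s u Φ state k c' ω : EReal)} =
        ENNReal.ofReal (M.nearestCCDF o s k c' v)) ∧
      (∀ B : Set ℝ, MeasurableSet B →
        P {ω | AerialNet.nearestDist M s u Φ state k c' ω ≠ ∞ ∧
            (AerialNet.nearestDist M s u Φ state k c' ω).toReal ∈ B} =
          ∫⁻ v in B, ENNReal.ofReal (M.nearestPDF o s k c' v))) ∧
    -- association probability
    (IntegrableOn (M.mainLinkWeight o a s t c) (Set.Ioi 0) ∧
      P (AerialNet.assocEvent state sel t c) = ENNReal.ofReal (M.assocProb o a s t c)) ∧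
    -- PDF of the main link distance, given the association
    (P (AerialNet.assocEvent state sel t c) ≠ 0 →
      HasPDF (AerialNet.mainLinkDist M s u Φ sel)
        (ProbabilityTheory.cond P (AerialNet.assocEvent state sel t c)) volume ∧
      pdf (AerialNet.mainLinkDist M s u Φ sel)
          (ProbabilityTheory.cond P (AerialNet.assocEvent state sel t c)) volume =ᵐ[volume]
        fun y => ENNReal.ofReal (M.mainLinkPDF o a s t c y)) := by
  refine ⟨fun k c' => ⟨fun v => hstate.measure_exceeding hΦ hindep (k, c') v,
    fun B hB => hstate.measure_nearestDist_mem hΦ hindep k c' hB⟩,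
    ⟨hstate.integrableOn_mainLinkWeight hΦ hindep a t c, ?_⟩, fun hpos => ?_⟩
  · rw [measure_congr (hstate.assocEvent_ae_eq hΦ hindep hsel t c),
      hstate.measure_nearestWins hΦ hindep]
  · obtain ⟨hY, hmap⟩ := hstate.map_mainLinkDist hΦ hindep hsel t c hpos
    have hf : AEMeasurable (fun y => ENNReal.ofReal (M.mainLinkPDF o a s t c y)) volume :=
      (M.measurable_mainLinkPDF o a s t c).ennreal_ofReal.aemeasurable
    have hpdf := hasPDF_of_map_eq_withDensity hY _ hf hmap
    exact ⟨hpdf, pdf.eq_of_map_eq_withDensity _ hf |>.1 hmap⟩
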